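/- **Setting.** Let $\theta\in\mathbb R$, $q>0$, $A\in GL_2(\mathbb R)$, let $R_\phi$ be the rotation of $\mathbb R^2$ by $\phi$, and put $A_1=q^{-1/2}R_{-\theta/2}A$, $A_2=q^{1/2}R_{\theta/2}A$, $\mathcal R_j=A_j\mathbb Z^2$, $\Gamma_j=A_j[0,1)^2$, $\mathcal R_j(N)=A_j\{-N,\dots,N\}^2$ and $\mathcal R_j^*=2\pi A_j^{-T}\mathbb Z^2$ for $j=1,2$. Assume that $(\mathcal R_1,\mathcal R_2)$ and $(\mathcal R_1^*,\mathcal R_2^*)$ are incommensurate: $G_1+G_2=0$ with $G_j\in\mathcal R_j^*$ only if $G_1=G_2=0$, and $R_1+R_2=0$ with $R_j\in\mathcal R_j$ only if $R_1=R_2=0$. Let $A_{\mathcal M}=(A_1^{-1}-A_2^{-1})^{-1}$, $\mathcal R_{\mathcal M}=A_{\mathcal M}\mathbb Z^2$, $\Gamma_{\mathcal M}=A_{\mathcal M}[0,1)^2$, and $D_{j\to 3-j}=I-A_{3-j}A_j^{-1}$. We write $|\Omega|$ for the area of $\Omega$, $\langle f\rangle_{\Omega}=\frac1{|\Omega|}\int_\Omega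 f(x)\,dx$ for averages, and identify $x\in\mathbb R^2$ with $(x,0)\in\mathbb R^3$. Let $\mathcal A_1,\mathcal A_2$ be finite sets and let $\tau_k^{(\alpha)}\in\mathbb R^2$ for $\alpha\in\mathcal A_k$. Let $u_k(\cdot,\alpha):\mathbb R^2\to\mathbb R^3$ ($k=1,2$, $\alpha\in\mathcal A_k$) be $\mathcal R_{\mathcal M}$-periodic and integrable on $\Gamma_{\mathcal M}$, and put $Y_k(x,\alpha)=x+\tau_k^{(\alpha)}+u_k(x,\alpha)$. Let $j\in\{1,2\}$. *Monolayer energies.* For functions $V^{\rm mono}_{\alpha}:(\mathbb R^3)^{\mathcal R_j\times\mathcal A_j}\to\mathbb R$, $\alpha\in\mathcal A_j$, let $$F_j(x)=\sum_{\alpha\in\mathcal A_j}V^{\rm mono}_{\alpha}\Big(\big(u_j(x+R',\alpha')-u_j(x,\alpha)\big)_{(R',\alpha')\in\mathcal R_j\times\mathcal A_j}\Big),\qquad \Phi^{\rm mono}_j(x)=\frac1{|\Gamma_j|}F_j(x),$$ $$e^{\rm mono}_{j,N,\gamma_j}=\frac1{|\Gamma_j|(2N+1)^2}\sum_{R\in\mathcal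 R_j(N)}F_j(R+\gamma_j),\qquad e^{\rm mono}_j=\frac1{|\Gamma_j|\,|A_j^{-1}\Gamma_{\mathcal M}|}\int_{A_j^{-1}\Gamma_{\mathcal M}}F_j(A_j\xi)\,d\xi .$$ *Interlayer energies.* For functions $V^{\rm inter}_{\alpha}:(\mathbb R^3)^{\mathcal R_{3-j}\times\mathcal A_{3-j}}\to\mathbb R$, $\alpha\in\mathcal A_j$, and $\gamma=(\gamma_1,\gamma_2)\in\Gamma_1\times\Gamma_2$, let $$H_j(x,z)=\sum_{\alpha\in\mathcal A_j}V^{\rm inter}_{\alpha}\Big(\big(Y_j(x,\alpha)-Y_{3-j}(z+R',\alpha')\big)_{(R',\alpha')\in\mathcal R_{3-j}\times\mathcal A_{3-j}}\Big),$$ $$e^{\rm inter}_{j,N,\gamma}=\frac1{|\Gamma_j|(2N+1)^2}\sum_{R\in\mathcal R_j(N)}H_j(R+\gamma_j,\gamma_{3-j}),\qquad e^{\rm inter}_{j,\gamma}=\frac1{|\Gamma_j|\,|A_j^{-1}\Gamma_{\mathcal M}|}\int_{A_j^{-1}\Gamma_{\mathcal M}}H_j(A_j\xi+\gamma_j,A_{3-j}\xi+\gamma_{3-j})\,d\xi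 ,$$ and define the generalized site potential $$\Phi^{\rm inter}_j(x,y)=\frac1{|\Gamma_j|}\sum_{\alpha\in\mathcal A_j}V^{\rm inter}_{\alpha}\Big(\big(y-R'+\tau_j^{(\alpha)}-\tau_{3-j}^{(\alpha')}+u_j(x,\alpha)-u_{3-j}(x-y+R',\alpha')\big)_{(R',\alpha')}\Big)$$ and its restriction $\Phi^{\rm inter}_{j,\gamma}(x)=\Phi^{\rm inter}_j\big(x,\,D_{j\to3-j}x+A_{3-j}A_j^{-1}\gamma_j-\gamma_{3-j}\big)$. **Theorem.** 1. (Monolayer.) If $\Phi^{\rm mono}_j\in L^1(\Gamma_{\mathcal M})$, then $e^{\rm mono}_j=\langle\Phi^{\rm mono}_j\rangle_{\Gamma_{\mathcal M}}$, and for almost every $(\gamma_1,\gamma_2)\in\Gamma_1\times\Gamma_2$ we have $\lim_{N\to\infty}e^{\rm mono}_{j,N,\gamma_j}=e^{\rm mono}_j$. 2. (Interlayer, many-body potentials.) Suppose that every $V=V^{\rm inter}_\alpha$ is even, $V(-a)=V(a)$, and translation-invariant, $V\big((a_{R'+R'',\alpha'})_{(R',\alpha')}\big)=V(a)$ for all $R''\in\mathcal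 R_{3-j}$. If $\Phi^{\rm inter}_j\in L^1(\Gamma_{\mathcal M}\times\Gamma_{3-j})$, then for almost every $\gamma=(\gamma_1,\gamma_2)\in\Gamma_1\times\Gamma_2$ we have $\Phi^{\rm inter}_{j,\gamma}\in L^1(\Gamma_{\mathcal M})$, $e^{\rm inter}_{j,\gamma}=\langle\Phi^{\rm inter}_{j,\gamma}\rangle_{\Gamma_{\mathcal M}}$ and $\lim_{N\to\infty}e^{\rm inter}_{j,N,\gamma}=e^{\rm inter}_{j,\gamma}$. 3. (Interlayer, pair potentials.) Let $v_{(\alpha_1,\alpha_2)}:\mathbb R^3\to\mathbb R$ be even functions, $(\alpha_1,\alpha_2)\in\mathcal A_1\times\mathcal A_2$, and let $$V^{\rm inter}_{\alpha_j}(a)=\tfrac12\sum_{(R',\alpha_{3-j})\in\mathcal R_{3-j}\times\mathcal A_{3-j}}v_{(\alpha_1,\alpha_2)}(a_{R',\alpha_{3-j}})$$ (understood as $0$ where the sum does not converge absolutely). Let $r>1$. Assume that $u_k(\cdot,\alpha_k)\in L^\infty(\mathbb R^2)$ for all $k$ and $\alpha_k$, and that every $v=v_{(\alpha_1,\alpha_2)}$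 lies in $L^\infty_{2r}\big(\mathbb R^2\times[-L^z,L^z]\big)$, that is, $v$ is Borel measurable on $\mathbb R^2\times[-L^z,L^z]$ and $\sup(1+|x|^2)^{r}|v(x)|<\infty$, the supremum being over all points $x$ of this slab; here $L^z=\max_{\alpha_1,\alpha_2}|\tau_1^{(\alpha_1)}-\tau_2^{(\alpha_2)}|+\|u_{1,z}\|_\infty+\|u_{2,z}\|_\infty$, where $\|u_{k,z}\|_\infty$ is the maximum over $\alpha_k$ of the essential suprema of the third components $|u_{k,z}(\cdot,\alpha_k)|$. Then for each $\alpha_j$ and almost every $(x,z)\in\mathbb R^2\times\mathbb R^2$ the sum that defines $V^{\rm inter}_{\alpha_j}$ converges absolutely at $a=\big(Y_j(x,\alpha_j)-Y_{3-j}(z+R',\alpha')\big)_{(R',\alpha')}$; moreover $\Phi^{\rm inter}_j\in L^1(\Gamma_{\mathcal M}\times\Gamma_{3-j})$, $\Phi^{\rm inter}_{j,\gamma}\in L^1(\Gamma_{\mathcal M})$ for every $\gamma\in\Gamma_1\times\Gamma_2$, and for almost every $\gamma\in\Gamma_1\times\Gamma_2$ we have $e^{\rm inter}_{j,\gamma}=\langle\Phi^{\rm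 inter}_{j,\gamma}\rangle_{\Gamma_{\mathcal M}}$ and $\lim_{N\to\infty}e^{\rm inter}_{j,N,\gamma}=e^{\rm inter}_{j,\gamma}$. -/

import Mathlib

open MeasureTheory Filter Topology

noncomputable section

namespace TwistedBilayer

/-- The Euclidean plane. -/
abbrev E2 : Type := EuclideanSpace ℝ (Fin 2)

/-- Euclidean 3-space. -/
abbrev E3 : Type := EuclideanSpace ℝ (Fin 3)

/-- Real `2 × 2` matrices. -/
abbrev Mat2 : Type := Matrix (Fin 2) (Fin 2) ℝ

/-- A matrix acting on the Euclidean plane. -/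
def act (M : Mat2) (x : E2) : E2 := Matrix.toEuclideanLin M x

/-- The embedding `x ↦ (x, 0)` of the plane into 3-space. -/
def embed (x : E2) : E3 := !₂[x 0, x 1, 0]

/-! ### Lattices

The layers are labelled by `Fin 2`: the index `0` is layer 1, the index `1` is layer 2, and
`1 - j` is the layer opposite to layer `j`. -/

/-- Rotation by the angle `φ`. -/
def rot (φ : ℝ) : Mat2 := !![Real.cos φ, -Real.sin φ; Real.sin φ, Real.cos φ]

/-- `A₁ = q^{-1/2} R_{-θ/2} A` and `A₂ = q^{1/2} R_{θ/2} A`. -/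
def layerMatrix (θ q : ℝ) (A : Mat2) : Fin 2 → Mat2 :=
  ![(Real.sqrt q)⁻¹ • (rot (-(θ / 2)) * A), Real.sqrt q • (rot (θ / 2) * A)]

/-- The point `M n` for an integer vector `n`. -/
def latticePoint (M : Mat2) (n : Fin 2 → ℤ) : E2 :=
  act M (WithLp.toLp 2 fun i => (n i : ℝ))

/-- The lattice `M ℤ²`. -/
def lattice (M : Mat2) : AddSubgroup E2 where
  carrier := Set.range (latticePoint M)
  zero_mem' := ⟨0, by
    have h : (WithLp.toLp 2 fun i => (((0 : Fin 2 → ℤ) i : ℤ) : ℝ)) = (0 : E2) := by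
      ext i; simp
    rw [latticePoint, h, act, map_zero]⟩
  add_mem' := by
    rintro _ _ ⟨m, rfl⟩ ⟨n, rfl⟩
    refine ⟨m + n, ?_⟩
    have h : (WithLp.toLp 2 fun i => (((m + n) i : ℤ) : ℝ)) =
        ((WithLp.toLp 2 fun i => (m i : ℝ)) + WithLp.toLp 2 fun i => (n i : ℝ) : E2) := by
      ext i; simp
    simp only [latticePoint, act] at h ⊢
    rw [h, map_add]
  neg_mem' := by
    rintro _ ⟨m, rfl⟩
    refine ⟨-m, ?_⟩
    have h : (WithLp.toLp 2 fun i => (((-m) i : ℤ) : ℝ)) =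
        (-(WithLp.toLp 2 fun i => (m i : ℝ)) : E2) := by
      ext i; simp
    simp only [latticePoint, act] at h ⊢
    rw [h, map_neg]

/-- The half-open unit cell `M [0,1)²`. -/
def cell (M : Mat2) : Set E2 := act M '' {t | ∀ i, t i ∈ Set.Ico (0 : ℝ) 1}

/-- The area of the unit cell. -/
def cellArea (M : Mat2) : ℝ := volume.real (cell M)

/-- The integer box `{-N, …, N}²`; the truncated lattice is its image under `latticePoint M`. -/
def box (N : ℕ) : Finset (Fin 2 → ℤ) :=
  Fintype.piFinset fun _ => Finset.Icc (-(N : ℤ)) (N : ℤ)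

/-- The matrix `2π M^{-T}` of reciprocal vectors. -/
def reciprocal (M : Mat2) : Mat2 := (2 * Real.pi) • (M⁻¹).transpose

/-- The lattices `M ℤ²` and `M' ℤ²` are incommensurate: for `G`, `G'` in the respective reciprocal
lattices, `G + G' = 0` only if `G = G' = 0`. -/
def Incommensurate (M M' : Mat2) : Prop :=
  ∀ G ∈ lattice (reciprocal M), ∀ G' ∈ lattice (reciprocal M'), G + G' = 0 ↔ G = 0 ∧ G' = 0

/-- The moiré matrix `(A₁⁻¹ - A₂⁻¹)⁻¹`. -/
def moireMatrix (L : Fin 2 → Mat2) : Mat2 := ((L 0)⁻¹ - (L 1)⁻¹)⁻¹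

/-- The disregistry matrix `I - A_{3-j} A_j⁻¹`. -/
def disregistry (L : Fin 2 → Mat2) (j : Fin 2) : Mat2 := 1 - L (1 - j) * (L j)⁻¹

/-- Periodicity with respect to the moiré lattice. -/
def MoirePeriodic (L : Fin 2 → Mat2) (f : E2 → E3) : Prop :=
  ∀ R ∈ lattice (moireMatrix L), ∀ x, f (x + R) = f x

/-! ### Monolayer energies -/

section Mono

variable {S : Type*} [Fintype S]

/-- The stencil of relative differences `u(x + R', α') - u(x, α)`, indexed by `(R', α')`. -/
def monoStencil (M : Mat2) (u : S → E2 → E3) (α : S) (x : E2) : lattice M × S → E3 :=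
  fun p => u p.2 (x + p.1) - u α x

/-- The sublattice-averaged monolayer site potential. -/
def monoSite (M : Mat2) (V : S → (lattice M × S → E3) → ℝ) (u : S → E2 → E3) (x : E2) : ℝ :=
  (cellArea M)⁻¹ * ∑ α, V α (monoStencil M u α x)

/-- The monolayer energy density of the truncated layer with lattice shift `γ`. -/
def monoEnergyN (M : Mat2) (V : S → (lattice M × S → E3) → ℝ) (u : S → E2 → E3)
    (γ : E2) (N : ℕ) : ℝ :=
  (cellArea M * (2 * (N : ℝ) + 1) ^ 2)⁻¹ *
    ∑ α, ∑ n ∈ box N, V α (monoStencil M u α (latticePoint M n + γ))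

/-- The limiting monolayer energy density: an average over `A_j⁻¹ Γ_ℳ`, where `P` is the moiré
matrix and `M` is the matrix `A_j` of the layer. -/
def monoEnergy (P M : Mat2) (V : S → (lattice M × S → E3) → ℝ) (u : S → E2 → E3) : ℝ :=
  (cellArea M)⁻¹ * ⨍ ξ in act M⁻¹ '' cell P, ∑ α, V α (monoStencil M u α (act M ξ))

end Mono

/-! ### Interlayer energies -/

section Inter

variable {𝒜 : Fin 2 → Type*} [∀ k, Fintype (𝒜 k)]

/-- The configurations on which the interlayer site potentials of layer `j` depend: families of
vectors indexed by the sites `(R_{3-j}, α_{3-j})` of the opposite layer. -/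
abbrev InterConfig (𝒜 : Fin 2 → Type*) (L : Fin 2 → Mat2) (j : Fin 2) : Type _ :=
  lattice (L (1 - j)) × 𝒜 (1 - j) → E3

/-- Invariance of a potential under lattice translations of the index. -/
def TranslationInvariant {L : Fin 2 → Mat2} {j : Fin 2} (V : InterConfig 𝒜 L j → ℝ) : Prop :=
  ∀ (a : InterConfig 𝒜 L j) (R : lattice (L (1 - j))), V (fun p => a (p.1 + R, p.2)) = V a

/-- The generalized lattice position `Y_k(x, α) = x + τ_k^{(α)} + u_k(x, α)`. -/
def position (τ : ∀ k, 𝒜 k → E2) (u : ∀ k, 𝒜 k → E2 → E3) (k : Fin 2) (α : 𝒜 k) (x : E2) : E3 :=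
  embed (x + τ k α) + u k α x

/-- The stencil `Y_j(x, α_j) - Y_{3-j}(y + R_{3-j}, α_{3-j})`, indexed by `(R_{3-j}, α_{3-j})`. -/
def interStencil (L : Fin 2 → Mat2) (τ : ∀ k, 𝒜 k → E2) (u : ∀ k, 𝒜 k → E2 → E3) (j : Fin 2)
    (α : 𝒜 j) (x y : E2) : InterConfig 𝒜 L j :=
  fun p => position τ u j α x - position τ u (1 - j) p.2 (y + p.1)

/-- The interlayer energy density of the truncated layer `j` for the lattice shifts `γ`. -/
def interEnergyN (L : Fin 2 → Mat2) (τ : ∀ k, 𝒜 k → E2) (j : Fin 2)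
    (V : 𝒜 j → InterConfig 𝒜 L j → ℝ) (u : ∀ k, 𝒜 k → E2 → E3) (γ : Fin 2 → E2) (N : ℕ) : ℝ :=
  (cellArea (L j) * (2 * (N : ℝ) + 1) ^ 2)⁻¹ *
    ∑ n ∈ box N, ∑ α,
      V α (interStencil L τ u j α (latticePoint (L j) n + γ j) (γ (1 - j)))

/-- The sublattice-averaged generalized interlayer site potential of layer `j`. -/
def interSite (L : Fin 2 → Mat2) (τ : ∀ k, 𝒜 k → E2) (j : Fin 2)
    (V : 𝒜 j → InterConfig 𝒜 L j → ℝ) (u : ∀ k, 𝒜 k → E2 → E3) (x y : E2) : ℝ :=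
  (cellArea (L j))⁻¹ * ∑ α, V α (fun p =>
    embed (y - p.1 + τ j α - τ (1 - j) p.2) + u j α x - u (1 - j) p.2 (x - y + p.1))

/-- The diagonal site potential `x ↦ Φ_j(x, D_{j→3-j} x + A_{3-j} A_j⁻¹ γ_j - γ_{3-j})`. -/
def interSiteDiag (L : Fin 2 → Mat2) (τ : ∀ k, 𝒜 k → E2) (j : Fin 2)
    (V : 𝒜 j → InterConfig 𝒜 L j → ℝ) (u : ∀ k, 𝒜 k → E2 → E3) (γ : Fin 2 → E2) (x : E2) : ℝ :=
  interSite L τ j V u x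
    (act (disregistry L j) x + act (L (1 - j) * (L j)⁻¹) (γ j) - γ (1 - j))

/-- The limiting interlayer energy density of layer `j`: an average over `A_j⁻¹ Γ_ℳ`. -/
def interEnergy (L : Fin 2 → Mat2) (τ : ∀ k, 𝒜 k → E2) (j : Fin 2)
    (V : 𝒜 j → InterConfig 𝒜 L j → ℝ) (u : ∀ k, 𝒜 k → E2 → E3) (γ : Fin 2 → E2) : ℝ :=
  (cellArea (L j))⁻¹ * ⨍ ξ in act (L j)⁻¹ '' cell (moireMatrix L), ∑ α,
    V α (interStencil L τ u j α (act (L j) ξ + γ j) (act (L (1 - j)) ξ + γ (1 - j)))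

/-! ### Pair potentials -/

/-- The pair `(α₁, α₂)`, ordered by layer, formed by `α` in layer `j` and `β` in the opposite
layer. -/
def orderedPair : (j : Fin 2) → 𝒜 j → 𝒜 (1 - j) → 𝒜 0 × 𝒜 1
  | 0, α, β => (α, β)
  | 1, α, β => (β, α)

/-- The interlayer site potential `a ↦ ½ ∑ v_{(α₁,α₂)}(a_{R_{3-j},α_{3-j}})` of layer `j` that
belongs to the pair potentials `v`. -/
def pairPotential (L : Fin 2 → Mat2) (v : 𝒜 0 × 𝒜 1 → E3 → ℝ) (j : Fin 2) (α : 𝒜 j)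
    (a : InterConfig 𝒜 L j) : ℝ :=
  (1 / 2) * ∑' p : lattice (L (1 - j)) × 𝒜 (1 - j), v (orderedPair j α p.2) (a p)

/-- `max |τ₁^{(α₁)} - τ₂^{(α₂)}|`. -/
def sublatticeDist (τ : ∀ k, 𝒜 k → E2) : ℝ := ⨆ p : 𝒜 0 × 𝒜 1, ‖τ 0 p.1 - τ 1 p.2‖

/-- `‖u_{k,z}‖_∞`: the maximum over the sublattices of the essential suprema of the vertical
components. -/
def verticalNorm (u : ∀ k, 𝒜 k → E2 → E3) (k : Fin 2) : ℝ :=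
  ⨆ α : 𝒜 k, (eLpNorm (fun x => u k α x 2) ⊤ volume).toReal

/-- The slab half-height `L_u^z = max |τ₁^{(α₁)} - τ₂^{(α₂)}| + ‖u_{1,z}‖_∞ + ‖u_{2,z}‖_∞`. -/
def slabHeight (τ : ∀ k, 𝒜 k → E2) (u : ∀ k, 𝒜 k → E2 → E3) : ℝ :=
  sublatticeDist τ + verticalNorm u 0 + verticalNorm u 1

/-- The slab `ℝ² × [-h, h]`. -/
def slab (h : ℝ) : Set E3 := {x | x 2 ∈ Set.Icc (-h) h}

/-- `⟨x⟩ = (1 + |x|²)^{1/2}`. -/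
def bracket (x : E3) : ℝ := Real.sqrt (1 + ‖x‖ ^ 2)

/-- The weighted space `L^∞_s(Ω)` for functions that are defined pointwise: `f` is Borel measurable
on `Ω` and `⟨x⟩^s f` is bounded on `Ω`. A pair potential is evaluated at atomic positions, which may
all lie in a Lebesgue null set of 3-space (a horizontal plane, say), so that the bound has to hold
at every point and not only almost everywhere. -/
def WeightedBounded (s : ℝ) (Ω : Set E3) (f : E3 → ℝ) : Prop :=
  Measurable (fun x : Ω => f x) ∧ ∃ C : ℝ, ∀ x ∈ Ω, bracket x ^ s * |f x| ≤ C

end Inter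

end TwistedBilayer

end

/-! The lattice `ℛ_j` acts by translations on the moiré torus `ℝ²/ℛ_ℳ`, and the energy of a
truncated layer is a box average along an orbit of this `ℤ²`-action. The theorem is thus a pointwise
ergodic theorem for torus translations, combined with changes of variables.

Ergodicity: since `A_ℳ⁻¹ = A₁⁻¹ - A₂⁻¹`, a nontrivial character of the moiré torus that is trivial
on `ℛ_j` would produce a nontrivial coincidence of reciprocal vectors
(`nonresonant_latticeHom_moireMatrix`). Box averages of characters are products of geometric sums,
so they converge everywhere; density extends this to continuous functions
(`tendsto_boxAverage_continuousMap`), and the weak-type inequality `measure_maximal_le`, obtained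
from a Vitali covering, extends it almost everywhere to `L¹`.

Interlayer energies: translation invariance makes the site potential a function `G` on the product
of the moiré torus and the torus of the opposite layer, but the layer samples it only on a
two-dimensional diagonal, a null set. Disregistry descends to plus or minus the identity between the
tori, so every diagonal has the form `{(s, ±s + c)}`. A shear straightens these sets into slices
with fixed `c`, and each orbit stays in one slice. Fubini gives integrability and convergence for
almost every `(s, c)`, and `γ ↦ (s, c)` pulls null sets back to null sets
(`ae_integrableOn_and_tendsto_interEnergyN`).

Pair potentials: decay of order `2r > 2` makes the sum over a planar lattice converge absolutely
with a bound uniform in the positions (`exists_bound_pairSum`). The site potential is then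
measurable and essentially bounded, hence integrable on cells, and the many-body result applies. -/

noncomputable section

namespace TwistedBilayer

open scoped ENNReal

/-! ### Box averages over `ℤ²` and the maximal inequality -/

lemma mem_box {N : ℕ} {n : Fin 2 → ℤ} : n ∈ box N ↔ ∀ i, |n i| ≤ N := by
  simp [box, Fintype.mem_piFinset, Finset.mem_Icc, abs_le]

lemma card_box (N : ℕ) : (box N).card = (2 * N + 1) ^ 2 := by
  have h : ((N : ℤ) + 1 + (N : ℤ)).toNat = 2 * N + 1 := by omega
  simp [box, Fintype.card_piFinset, Int.card_Icc, h]

lemma box_mono {M N : ℕ} (h : M ≤ N) : box M ⊆ box N := by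
  intro n hn
  rw [mem_box] at hn ⊢
  intro i
  have := hn i
  omega

lemma mem_box_iff_norm_le {N : ℕ} {n : Fin 2 → ℤ} : n ∈ box N ↔ ‖n‖ ≤ N := by
  rw [mem_box, pi_norm_le_iff_of_nonneg (Nat.cast_nonneg N)]
  refine forall_congr' fun i => ?_
  rw [Int.norm_eq_abs]
  exact_mod_cast Iff.rfl

/-- Integer vectors carry the sup norm, so translated boxes are metric balls and the metric Vitali
covering lemma applies to them. -/
lemma mem_closedBall_iff_sub_mem_box {N : ℕ} {m n : Fin 2 → ℤ} :
    m ∈ Metric.closedBall n (N : ℝ) ↔ m - n ∈ box N := by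
  rw [mem_box_iff_norm_le, Metric.mem_closedBall, dist_eq_norm]

/-- Vitali covering: the points around which some box average of `φ` exceeds `t`. -/
lemma card_mul_le_of_le_sum_box (φ : (Fin 2 → ℤ) → ℝ≥0∞) (t : ℝ≥0∞) (J K : ℕ)
    (S : Finset (Fin 2 → ℤ)) (hS : S ⊆ box J)
    (h : ∀ n ∈ S, ∃ N ≤ K, t * (box N).card ≤ ∑ m ∈ box N, φ (m + n)) :
    t * S.card ≤ 16 * ∑ m ∈ box (J + K), φ m := by
  classical
  choose! r hrK hr using h
  -- The covering lemma admits any enlargement factor above 3; the integer 4 keeps the enlarged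
  -- balls boxes.
  obtain ⟨U, hUS, hdisj, hcov⟩ := Vitali.exists_disjoint_subfamily_covering_enlargement_closedBall
    (S : Set (Fin 2 → ℤ)) id (fun n => (r n : ℝ)) K
    (fun n hn => by exact_mod_cast hrK n hn) 4 (by norm_num)
  have hUfin : U.Finite := S.finite_toSet.subset hUS
  set W := hUfin.toFinset with hW
  have hWS : ∀ n ∈ W, n ∈ S := fun n hn => hUS (hUfin.mem_toFinset.1 hn)
  let B : (Fin 2 → ℤ) → ℕ → Finset (Fin 2 → ℤ) := fun n N => (box N).map (addRightEmbedding n)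
  have hB : ∀ n N m, m ∈ B n N ↔ m ∈ Metric.closedBall n (N : ℝ) := by
    intro n N m
    rw [mem_closedBall_iff_sub_mem_box]
    simp only [B, Finset.mem_map, addRightEmbedding_apply]
    constructor
    · rintro ⟨a, ha, rfl⟩
      simpa using ha
    · intro h
      exact ⟨_, h, by simp⟩
  have hcover : S ⊆ W.biUnion fun n => B n (4 * r n) := by
    intro n hn
    obtain ⟨b, hb, hsub⟩ := hcov n hn
    rw [Finset.mem_biUnion]
    refine ⟨b, hUfin.mem_toFinset.2 hb, ?_⟩
    rw [hB]
    have := hsub (Metric.mem_closedBall_self (Nat.cast_nonneg _))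
    simpa using this
  -- The constant 16 is the square of the enlargement factor, the lattice having rank two.
  have hcard : S.card ≤ ∑ n ∈ W, 16 * (box (r n)).card := by
    refine (Finset.card_le_card hcover).trans (Finset.card_biUnion_le.trans ?_)
    refine Finset.sum_le_sum fun n _ => ?_
    simp only [B, Finset.card_map, card_box]
    calc (2 * (4 * r n) + 1) ^ 2 ≤ (4 * (2 * r n + 1)) ^ 2 := Nat.pow_le_pow_left (by omega) 2
      _ = 16 * (2 * r n + 1) ^ 2 := by ring
  have hpd : (W : Set (Fin 2 → ℤ)).PairwiseDisjoint fun n => B n (r n) := by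
    intro a ha b hb hab
    rw [Function.onFun, Finset.disjoint_left]
    intro m hm hm'
    rw [hB] at hm hm'
    have := hdisj (hUfin.mem_toFinset.1 ha) (hUfin.mem_toFinset.1 hb) hab
    exact Set.disjoint_left.1 this hm hm'
  have hsub : W.biUnion (fun n => B n (r n)) ⊆ box (J + K) := by
    intro m hm
    rw [Finset.mem_biUnion] at hm
    obtain ⟨n, hn, hm⟩ := hm
    simp only [B, Finset.mem_map, addRightEmbedding_apply] at hm
    obtain ⟨a, ha, rfl⟩ := hm
    have h1 := mem_box.1 (hS (hWS n hn))
    have h2 := mem_box.1 (box_mono (hrK n (hWS n hn)) ha)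
    rw [mem_box]
    intro i
    have := abs_add_le (a i) (n i)
    have := h1 i
    have := h2 i
    simp only [Pi.add_apply]
    push_cast
    linarith
  calc t * S.card ≤ t * ((∑ n ∈ W, 16 * (box (r n)).card : ℕ) : ℝ≥0∞) := by gcongr
    _ = 16 * ∑ n ∈ W, t * (box (r n)).card := by
        push_cast
        rw [Finset.mul_sum, Finset.mul_sum]
        refine Finset.sum_congr rfl fun n _ => by ring
    _ ≤ 16 * ∑ n ∈ W, ∑ m ∈ B n (r n), φ m := by
        gcongr with n hn
        simpa [B] using hr n (hWS n hn)
    _ = 16 * ∑ m ∈ W.biUnion (fun n => B n (r n)), φ m := by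
        rw [Finset.sum_biUnion hpd]
    _ ≤ 16 * ∑ m ∈ box (J + K), φ m := by
        gcongr

/-- The weak-type maximal inequality for box averages of a measure-preserving `ℤ²`-action. -/
theorem measure_maximal_le {X : Type*} [MeasurableSpace X] {μ : Measure X}
    (a : (Fin 2 → ℤ) → X → X) (ha : ∀ n, MeasurePreserving (a n) μ μ)
    (hadd : ∀ m n x, a (m + n) x = a m (a n x)) {f : X → ℝ≥0∞} (hf : Measurable f) (t : ℝ≥0∞) :
    t * μ {x | ∃ N, t * (box N).card ≤ ∑ n ∈ box N, f (a n x)} ≤ 64 * ∫⁻ x, f x ∂μ := by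
  classical
  have hmeas : ∀ N, Measurable fun x => ∑ n ∈ box N, f (a n x) := fun N =>
    Finset.measurable_sum _ fun n _ => hf.comp (ha n).measurable
  -- Bounding the radii by `K` confines the sums seen from `box K` to `box (K + K)`; the limit in
  -- `K` is monotone.
  let E : ℕ → Set X := fun K => ⋃ N ≤ K, {x | t * (box N).card ≤ ∑ n ∈ box N, f (a n x)}
  have hE : ∀ K, MeasurableSet (E K) := fun K =>
    MeasurableSet.biUnion (Set.to_countable _) fun N _ =>
      measurableSet_le measurable_const (hmeas N)
  have hmono : Monotone E := fun K K' h => Set.biUnion_subset_biUnion_left fun N hN => le_trans hN h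
  have hUnion : {x | ∃ N, t * (box N).card ≤ ∑ n ∈ box N, f (a n x)} = ⋃ K, E K := by
    ext x
    simp only [E, Set.mem_iUnion, Set.mem_ofPred_eq, exists_prop]
    exact ⟨fun ⟨N, h⟩ => ⟨N, N, le_rfl, h⟩, fun ⟨_, N, _, h⟩ => ⟨N, h⟩⟩
  rw [hUnion, hmono.measure_iUnion, ENNReal.mul_iSup]
  refine iSup_le fun K => ?_
  -- Transference: the covering estimate is applied on the orbit of each `x` and then integrated,
  -- where invariance of `μ` makes all terms of a box sum equal.
  have hsum : t * ((box K).card * μ (E K)) ≤ 16 * ((box (K + K)).card * ∫⁻ x, f x ∂μ) := by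
    have h1 : ((box K).card : ℝ≥0∞) * μ (E K) =
        ∫⁻ x, ∑ n ∈ box K, (a n ⁻¹' E K).indicator 1 x ∂μ := by
      rw [lintegral_finsetSum _ fun n _ => measurable_one.indicator ((ha n).measurable (hE K))]
      rw [Finset.sum_congr rfl fun n _ => lintegral_indicator_one ((ha n).measurable (hE K))]
      rw [Finset.sum_congr rfl fun n _ => (ha n).measure_preimage (hE K).nullMeasurableSet]
      simp
    have h2 : ((box (K + K)).card : ℝ≥0∞) * ∫⁻ x, f x ∂μ =
        ∫⁻ x, ∑ n ∈ box (K + K), f (a n x) ∂μ := by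
      rw [lintegral_finsetSum (f := fun n x => f (a n x)) _ fun n _ => hf.comp (ha n).measurable]
      rw [Finset.sum_congr rfl fun n _ => (ha n).lintegral_comp hf]
      simp
    rw [h1, h2, ← lintegral_const_mul _ (hmeas _), ← lintegral_const_mul]
    swap
    · exact Finset.measurable_sum _ fun n _ =>
        measurable_one.indicator ((ha n).measurable (hE K))
    refine lintegral_mono fun x => ?_
    have := card_mul_le_of_le_sum_box (fun n => f (a n x)) t K K
      ((box K).filter fun n => a n x ∈ E K) (Finset.filter_subset _ _) (by
        intro n hn
        have := (Finset.mem_filter.1 hn).2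
        simp only [E, Set.mem_iUnion, exists_prop, Set.mem_ofPred_eq] at this
        obtain ⟨N, hN, h⟩ := this
        exact ⟨N, hN, by simpa [hadd] using h⟩)
    refine le_trans (le_of_eq ?_) this
    congr 1
    rw [Finset.card_filter]
    push_cast
    refine Finset.sum_congr rfl fun n _ => ?_
    simp [Set.indicator_apply]
  have hc0 : ((box K).card : ℝ≥0∞) ≠ 0 := by
    rw [card_box]
    positivity
  have hctop : ((box K).card : ℝ≥0∞) ≠ ∞ := ENNReal.natCast_ne_top _
  -- Doubling the radius costs a factor 4, whence `64 = 16 * 4`.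
  have h4 : ((box (K + K)).card : ℝ≥0∞) ≤ 4 * (box K).card := by
    rw [card_box, card_box]
    norm_cast
    calc (2 * (K + K) + 1) ^ 2 ≤ (2 * (2 * K + 1)) ^ 2 := Nat.pow_le_pow_left (by omega) 2
      _ = 4 * (2 * K + 1) ^ 2 := by ring
  have h5 : (box K).card * (t * μ (E K)) ≤ (box K).card * (64 * ∫⁻ x, f x ∂μ) := by
    calc ((box K).card : ℝ≥0∞) * (t * μ (E K)) = t * ((box K).card * μ (E K)) := by ring
      _ ≤ 16 * ((box (K + K)).card * ∫⁻ x, f x ∂μ) := hsum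
      _ ≤ 16 * ((4 * (box K).card) * ∫⁻ x, f x ∂μ) := by gcongr
      _ = (box K).card * (64 * ∫⁻ x, f x ∂μ) := by ring
  exact (ENNReal.mul_le_mul_iff_right hc0 hctop).1 h5

/-! ### Box averages and characters of the torus -/

/-- The two-dimensional torus. -/
abbrev Torus : Type := UnitAddTorus (Fin 2)

instance : IsProbabilityMeasure (volume : Measure UnitAddCircle) := ⟨UnitAddCircle.measure_univ⟩

/-- The average of a family over the box `{-N, …, N}²`. -/
def boxAverage {E : Type*} [AddCommMonoid E] [Module ℝ E] (f : (Fin 2 → ℤ) → E) (N : ℕ) : E :=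
  ((2 * (N : ℝ) + 1) ^ 2)⁻¹ • ∑ n ∈ box N, f n

section BoxAverage

variable {E : Type*} [NormedAddCommGroup E] [NormedSpace ℝ E]

lemma card_box_real (N : ℕ) : ((box N).card : ℝ) = (2 * (N : ℝ) + 1) ^ 2 := by
  rw [card_box]; push_cast; rfl

lemma boxAverage_const (c : E) (N : ℕ) : boxAverage (fun _ => c) N = c := by
  have h : (2 * (N : ℝ) + 1) ^ 2 ≠ 0 := by positivity
  rw [boxAverage, Finset.sum_const, ← Nat.cast_smul_eq_nsmul ℝ, card_box_real, smul_smul,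
    inv_mul_cancel₀ h, one_smul]

lemma boxAverage_sub (f g : (Fin 2 → ℤ) → E) (N : ℕ) :
    boxAverage (fun n => f n - g n) N = boxAverage f N - boxAverage g N := by
  rw [boxAverage, Finset.sum_sub_distrib, smul_sub]; rfl

lemma boxAverage_add (f g : (Fin 2 → ℤ) → E) (N : ℕ) :
    boxAverage (fun n => f n + g n) N = boxAverage f N + boxAverage g N := by
  rw [boxAverage, Finset.sum_add_distrib, smul_add]; rfl

lemma norm_boxAverage_le (f : (Fin 2 → ℤ) → E) (N : ℕ) :
    ‖boxAverage f N‖ ≤ boxAverage (fun n => ‖f n‖) N := by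
  have h : 0 ≤ ((2 * (N : ℝ) + 1) ^ 2)⁻¹ := by positivity
  rw [boxAverage, boxAverage, norm_smul, Real.norm_of_nonneg h, smul_eq_mul]
  gcongr
  exact norm_sum_le _ _

lemma norm_boxAverage_le_of_le {f : (Fin 2 → ℤ) → E} {C : ℝ} (h : ∀ n, ‖f n‖ ≤ C) (N : ℕ) :
    ‖boxAverage f N‖ ≤ C := by
  refine (norm_boxAverage_le f N).trans ?_
  rw [← boxAverage_const C N, boxAverage, boxAverage]
  gcongr with n
  exact h n

end BoxAverage

lemma sub_one_mul_sum_zpow {z : ℂ} (hz : z ≠ 0) (N : ℕ) :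
    (z - 1) * ∑ m ∈ Finset.Icc (-(N : ℤ)) N, z ^ m = z ^ ((N : ℤ) + 1) - z ^ (-(N : ℤ)) := by
  induction N with
  | zero => simp
  | succ N ih =>
    have h : Finset.Icc (-((N + 1 : ℕ) : ℤ)) ((N + 1 : ℕ) : ℤ) =
        insert (-((N : ℤ) + 1)) (insert ((N : ℤ) + 1) (Finset.Icc (-(N : ℤ)) N)) := by
      ext m
      simp only [Finset.mem_Icc, Finset.mem_insert]
      push_cast
      omega
    rw [h, Finset.sum_insert, Finset.sum_insert, mul_add, mul_add, ih]
    · have e1 : z ^ (-(N : ℤ)) = z ^ (-((N : ℤ) + 1)) * z := by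
        rw [← zpow_add_one₀ hz]; congr 1; ring
      have e2 : z ^ (((N + 1 : ℕ) : ℤ) + 1) = z ^ ((N : ℤ) + 1) * z := by
        rw [← zpow_add_one₀ hz]; push_cast; rfl
      have e3 : (-((N + 1 : ℕ) : ℤ)) = -((N : ℤ) + 1) := by push_cast; rfl
      rw [e1, e2, e3]
      ring
    · simp
    · simp only [Finset.mem_insert, Finset.mem_Icc]
      omega

lemma norm_sum_zpow_le {z : ℂ} (hz : ‖z‖ = 1) (N : ℕ) :
    ‖∑ m ∈ Finset.Icc (-(N : ℤ)) N, z ^ m‖ ≤ 2 * N + 1 := by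
  refine (norm_sum_le _ _).trans ?_
  simp only [norm_zpow, hz, one_zpow, Finset.sum_const, Int.card_Icc, nsmul_eq_mul, mul_one]
  have : ((N : ℤ) + 1 - -(N : ℤ)).toNat = 2 * N + 1 := by omega
  rw [this]
  push_cast
  rfl

lemma norm_sum_zpow_le_div {z : ℂ} (hz : ‖z‖ = 1) (hz1 : z ≠ 1) (N : ℕ) :
    ‖∑ m ∈ Finset.Icc (-(N : ℤ)) N, z ^ m‖ ≤ 2 / ‖z - 1‖ := by
  have h0 : z ≠ 0 := by
    rintro rfl
    simp at hz
  rw [le_div_iff₀ (norm_pos_iff.2 (sub_ne_zero.2 hz1)), mul_comm, ← norm_mul,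
    sub_one_mul_sum_zpow h0]
  refine (norm_sub_le _ _).trans ?_
  rw [norm_zpow, norm_zpow, hz, one_zpow, one_zpow]
  norm_num

/-- The box sum factors over the coordinates. The geometric sum with ratio `z i ≠ 1` stays bounded
and the other grows at most linearly, so dividing by `(2N+1)²` leaves a term of order `1/N`. -/
lemma tendsto_boxAverage_zpow {z : Fin 2 → ℂ} (hz : ∀ i, ‖z i‖ = 1) (hz1 : ∃ i, z i ≠ 1) :
    Tendsto (boxAverage fun n => ∏ i, z i ^ n i) atTop (𝓝 0) := by
  obtain ⟨i, hi⟩ := hz1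
  have key : ∀ N : ℕ, ‖boxAverage (fun n => ∏ i, z i ^ n i) N‖ ≤
      2 / ‖z i - 1‖ * (2 * (N : ℝ) + 1)⁻¹ := by
    intro N
    have hpos : 0 < 2 * (N : ℝ) + 1 := by positivity
    have hprod : ‖∑ n ∈ box N, ∏ i, z i ^ n i‖ ≤ 2 / ‖z i - 1‖ * (2 * N + 1) := by
      rw [box, ← Finset.prod_univ_sum (fun _ => Finset.Icc (-(N : ℤ)) (N : ℤ))
        (fun i m => z i ^ m), norm_prod,
        ← Finset.mul_prod_erase Finset.univ _ (Finset.mem_univ i)]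
      have hc : (Finset.univ.erase i).card = 1 := by simp
      refine mul_le_mul (norm_sum_zpow_le_div (hz i) hi N) ?_
        (Finset.prod_nonneg fun _ _ => norm_nonneg _) (by positivity)
      refine (Finset.prod_le_prod (fun _ _ => norm_nonneg _)
        fun k _ => norm_sum_zpow_le (hz k) N).trans ?_
      rw [Finset.prod_const, hc, pow_one]
    rw [boxAverage, norm_smul, norm_inv, norm_pow, Real.norm_of_nonneg hpos.le]
    calc ((2 * (N : ℝ) + 1) ^ 2)⁻¹ * ‖∑ n ∈ box N, ∏ i, z i ^ n i‖
        ≤ ((2 * (N : ℝ) + 1) ^ 2)⁻¹ * (2 / ‖z i - 1‖ * (2 * N + 1)) := by gcongr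
      _ = 2 / ‖z i - 1‖ * (2 * (N : ℝ) + 1)⁻¹ := by field_simp
  refine squeeze_zero_norm key ?_
  rw [← mul_zero (2 / ‖z i - 1‖)]
  refine Tendsto.const_mul _ (tendsto_inv_atTop_zero.comp ?_)
  exact tendsto_atTop_add_const_right _ _
    (tendsto_natCast_atTop_atTop.const_mul_atTop (by norm_num))

/-- The character of the torus given by a Fourier monomial. -/
def torusChar (k : Fin 2 → ℤ) : AddChar Torus ℂ where
  toFun x := UnitAddTorus.mFourier k x
  map_zero_eq_one' := by simp [UnitAddTorus.mFourier]
  map_add_eq_mul' x y := by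
    simp only [UnitAddTorus.mFourier, ContinuousMap.coe_mk, ← Finset.prod_mul_distrib]
    refine Finset.prod_congr rfl fun i _ => ?_
    rw [Pi.add_apply, fourier_apply, fourier_apply, fourier_apply, smul_add, AddCircle.toCircle_add]
    rfl

lemma norm_torusChar (k : Fin 2 → ℤ) (x : Torus) : ‖torusChar k x‖ = 1 := by
  change ‖UnitAddTorus.mFourier k x‖ = 1
  simp [UnitAddTorus.mFourier, fourier_apply, Circle.norm_coe]

lemma torusChar_hom_apply (k : Fin 2 → ℤ) (φ : (Fin 2 → ℤ) →+ Torus) (n : Fin 2 → ℤ) :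
    torusChar k (φ n) = ∏ i, torusChar k (φ (Pi.single i 1)) ^ n i := by
  have h : n = n 0 • Pi.single 0 1 + n 1 • Pi.single 1 1 := by
    ext i
    fin_cases i <;> simp
  conv_lhs => rw [h]
  rw [map_add, map_zsmul, map_zsmul, AddChar.map_add_eq_mul, AddChar.map_zsmul_eq_zpow,
    AddChar.map_zsmul_eq_zpow, Fin.prod_univ_two]

lemma exists_torusChar_single_ne_one {k : Fin 2 → ℤ} {φ : (Fin 2 → ℤ) →+ Torus}
    (h : ∃ n, torusChar k (φ n) ≠ 1) : ∃ i, torusChar k (φ (Pi.single i 1)) ≠ 1 := by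
  by_contra! h1
  obtain ⟨n, hn⟩ := h
  exact hn (by simp [torusChar_hom_apply, h1])

/-- The condition that the translations by `φ n` act ergodically on the torus: no nontrivial
character is trivial on the range of `φ`. -/
def Nonresonant (φ : (Fin 2 → ℤ) →+ Torus) : Prop :=
  ∀ k : Fin 2 → ℤ, k ≠ 0 → ∃ n, torusChar k (φ n) ≠ 1

/-- Translation by `a` preserves the integral and also multiplies it by `torusChar k a`. -/
lemma integral_torusChar {k : Fin 2 → ℤ} {a : Torus} (ha : torusChar k a ≠ 1) :
    ∫ t : Torus, torusChar k t = 0 := by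
  have h := integral_add_right_eq_self (μ := (volume : Measure Torus)) (fun t => torusChar k t) a
  simp only [AddChar.map_add_eq_mul] at h
  rw [integral_mul_const] at h
  have h2 : (∫ t : Torus, torusChar k t) * (torusChar k a - 1) = 0 := by
    rw [mul_sub, h, mul_one, sub_self]
  exact (mul_eq_zero.1 h2).resolve_right (sub_ne_zero.2 ha)

lemma tendsto_boxAverage_torusChar {φ : (Fin 2 → ℤ) →+ Torus} (hφ : Nonresonant φ)
    (k : Fin 2 → ℤ) (s : Torus) :
    Tendsto (boxAverage fun n => torusChar k (s + φ n)) atTop (𝓝 (∫ t : Torus, torusChar k t)) := by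
  by_cases hk : k = 0
  · have h1 : ∀ x, torusChar k x = 1 := fun x => by
      change UnitAddTorus.mFourier k x = 1
      simp [hk, UnitAddTorus.mFourier_zero]
    have h2 : (fun n => torusChar k (s + φ n)) = fun _ => 1 := funext fun n => h1 _
    have h3 : boxAverage (fun _ => (1 : ℂ)) = fun _ => 1 := funext fun N => boxAverage_const 1 N
    rw [h2, h3, integral_congr_ae (.of_forall h1), integral_const, probReal_univ, one_smul]
    exact tendsto_const_nhds
  · obtain ⟨a, ha⟩ := hφ k hk
    rw [integral_torusChar ha]
    have h := (tendsto_boxAverage_zpow (fun i => norm_torusChar k (φ (Pi.single i 1)))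
      (exists_torusChar_single_ne_one ⟨a, ha⟩)).const_mul (torusChar k s)
    rw [mul_zero] at h
    refine h.congr fun N => ?_
    have h2 : (fun n => torusChar k (s + φ n)) = fun n =>
        torusChar k s * ∏ i, torusChar k (φ (Pi.single i 1)) ^ n i := funext fun n => by
      rw [AddChar.map_add_eq_mul, torusChar_hom_apply k φ n]
    rw [h2, boxAverage, boxAverage, ← Finset.mul_sum, mul_smul_comm]

lemma integrable_continuousMap (g : C(Torus, ℂ)) : Integrable g (volume : Measure Torus) :=
  (BoundedContinuousFunction.mkOfCompact g).integrable _

/-- Weyl equidistribution: box averages of a continuous function converge everywhere. -/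
lemma tendsto_boxAverage_continuousMap {φ : (Fin 2 → ℤ) →+ Torus} (hφ : Nonresonant φ)
    (g : C(Torus, ℂ)) (s : Torus) :
    Tendsto (boxAverage fun n => g (s + φ n)) atTop (𝓝 (∫ t, g t)) := by
  have hspan : ∀ p ∈ Submodule.span ℂ (Set.range <| UnitAddTorus.mFourier (d := Fin 2)),
      Tendsto (boxAverage fun n => p (s + φ n)) atTop (𝓝 (∫ t, p t)) := by
    intro p hp
    induction hp using Submodule.span_induction with
    | mem x hx =>
      obtain ⟨k, rfl⟩ := hx
      exact tendsto_boxAverage_torusChar hφ k s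
    | zero =>
      have : boxAverage (fun _ => (0 : ℂ)) = fun _ => 0 := funext fun N => boxAverage_const 0 N
      simp [this]
    | add x y _ _ hx hy =>
      simp only [ContinuousMap.add_apply]
      rw [integral_add (integrable_continuousMap x) (integrable_continuousMap y)]
      refine (hx.add hy).congr fun N => (boxAverage_add _ _ N).symm
    | smul c x _ hx =>
      simp only [ContinuousMap.smul_apply]
      rw [integral_smul]
      refine (hx.const_smul c).congr fun N => ?_
      rw [boxAverage, boxAverage, ← Finset.smul_sum, smul_comm]
  -- Trigonometric polynomials are uniformly dense, and both box averages and the integral are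
  -- contractions for the sup norm; an `ε/3` argument finishes.
  rw [Metric.tendsto_atTop]
  intro ε hε
  have hg : g ∈ closure (Submodule.span ℂ (Set.range <| UnitAddTorus.mFourier (d := Fin 2)) :
      Set C(Torus, ℂ)) := by
    have := UnitAddTorus.span_mFourier_closure_eq_top (d := Fin 2)
    rw [← Submodule.topologicalClosure_coe, this]
    trivial
  obtain ⟨p, hp, hgp⟩ := Metric.mem_closure_iff.1 hg (ε / 3) (by positivity)
  obtain ⟨N₀, hN₀⟩ := Metric.tendsto_atTop.1 (hspan p hp) (ε / 3) (by positivity)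
  refine ⟨N₀, fun N hN => ?_⟩
  have hpt : ∀ x, ‖g x - p x‖ ≤ dist g p := fun x => by
    rw [← dist_eq_norm]; exact ContinuousMap.dist_apply_le_dist x
  have h1 : dist (boxAverage (fun n => g (s + φ n)) N) (boxAverage (fun n => p (s + φ n)) N)
      ≤ dist g p := by
    rw [dist_eq_norm, ← boxAverage_sub]
    exact norm_boxAverage_le_of_le (fun n => hpt _) N
  have h2 : dist (∫ t, p t) (∫ t, g t) ≤ dist g p := by
    rw [dist_comm, dist_eq_norm, ← integral_sub (integrable_continuousMap g)
      (integrable_continuousMap p)]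
    refine (norm_integral_le_of_norm_le_const (.of_forall hpt)).trans ?_
    simp
  have h3 := hN₀ N hN
  have h4 := dist_triangle4 (boxAverage (fun n => g (s + φ n)) N)
    (boxAverage (fun n => p (s + φ n)) N) (∫ t, p t) (∫ t, g t)
  linarith

lemma tendsto_boxAverage_continuous {φ : (Fin 2 → ℤ) →+ Torus} (hφ : Nonresonant φ)
    {g : Torus → ℝ} (hg : Continuous g) (s : Torus) :
    Tendsto (boxAverage fun n => g (s + φ n)) atTop (𝓝 (∫ t, g t)) := by
  have h := tendsto_boxAverage_continuousMap hφ ⟨fun x => (g x : ℂ), by fun_prop⟩ s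
  simp only [ContinuousMap.coe_mk] at h
  rw [show ∫ t, ((g t : ℝ) : ℂ) = ((∫ t, g t : ℝ) : ℂ) from integral_ofReal] at h
  have h2 := (Complex.continuous_re.tendsto _).comp h
  refine h2.congr fun N => ?_
  simp only [boxAverage, Function.comp_apply, Complex.smul_re, Complex.re_sum, Complex.ofReal_re]

/-! ### The pointwise ergodic theorem on the torus -/

lemma measurePreserving_torus_add (a : Torus) :
    MeasurePreserving (fun s : Torus => s + a) volume volume :=
  measurePreserving_add_right volume a

/-- The pointwise ergodic theorem for the translations `s ↦ s + φ n`. -/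
theorem ae_tendsto_boxAverage_of_stronglyMeasurable {φ : (Fin 2 → ℤ) →+ Torus}
    (hφ : Nonresonant φ) {f : Torus → ℝ} (hfm : StronglyMeasurable f) (hf : Integrable f) :
    ∀ᵐ s, Tendsto (boxAverage fun n => f (s + φ n)) atTop (𝓝 (∫ t, f t)) := by
  -- For continuous `g` close to `f` in `L¹` the error has three parts: the average of `f - g`, the
  -- Weyl error for `g`, and the difference of the integrals. A bad point, where the error is at
  -- least `3 * δ` infinitely often, forces the first part to be at least `δ`.
  have key : ∀ δ : ℝ, 0 < δ → ∀ᵐ s, ∀ᶠ N in atTop,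
      dist (boxAverage (fun n => f (s + φ n)) N) (∫ t, f t) < 3 * δ := by
    intro δ hδ
    rw [ae_iff]
    by_contra hne
    set m := volume {s : Torus | ¬ ∀ᶠ N in atTop,
      dist (boxAverage (fun n => f (s + φ n)) N) (∫ t, f t) < 3 * δ} with hm
    have hle : ∀ ε : ℝ, 0 < ε → ε < δ → ENNReal.ofReal δ * m ≤ 64 * ENNReal.ofReal ε := by
      intro ε hε hεδ
      obtain ⟨g, hfg, hg⟩ := hf.exists_boundedContinuous_integral_sub_le hε
      have hmax := measure_maximal_le (μ := (volume : Measure Torus)) (fun n s => s + φ n)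
        (fun n => measurePreserving_torus_add (φ n))
        (fun a b s => by simp only [map_add]; abel)
        (f := fun s => ENNReal.ofReal ‖f s - g s‖)
        ((hfm.measurable.sub g.continuous.measurable).norm.ennreal_ofReal) (ENNReal.ofReal δ)
      rw [← ofReal_integral_eq_lintegral_ofReal (f := fun s => ‖f s - g s‖) (hf.sub hg).norm
        (.of_forall fun _ => norm_nonneg _)] at hmax
      refine le_trans ?_ (hmax.trans ?_)
      · gcongr
        rw [hm]
        refine measure_mono fun s hs => ?_
        rw [Set.mem_ofPred_eq] at hs ⊢
        have hgs := Metric.tendsto_nhds.1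
          (tendsto_boxAverage_continuous hφ g.continuous s) δ hδ
        have hfreq : ∃ᶠ N in atTop,
            ¬ dist (boxAverage (fun n => f (s + φ n)) N) (∫ t, f t) < 3 * δ := not_eventually.1 hs
        obtain ⟨N, hN1, hN2⟩ := (hfreq.and_eventually hgs).exists
        refine ⟨N, ?_⟩
        have h1 : dist (∫ t, g t) (∫ t, f t) ≤ ε := by
          rw [dist_comm, dist_eq_norm, ← integral_sub hf hg]
          exact (norm_integral_le_integral_norm _).trans hfg
        have h2 : dist (boxAverage (fun n => f (s + φ n)) N) (boxAverage (fun n => g (s + φ n)) N)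
            ≤ boxAverage (fun n => ‖f (s + φ n) - g (s + φ n)‖) N := by
          rw [dist_eq_norm, ← boxAverage_sub]
          exact norm_boxAverage_le _ N
        have h3 := dist_triangle4 (boxAverage (fun n => f (s + φ n)) N)
          (boxAverage (fun n => g (s + φ n)) N) (∫ t, g t) (∫ t, f t)
        have h4 : δ ≤ boxAverage (fun n => ‖f (s + φ n) - g (s + φ n)‖) N := by linarith
        have hpos : (0 : ℝ) < (2 * (N : ℝ) + 1) ^ 2 := by positivity
        rw [boxAverage, smul_eq_mul, inv_mul_eq_div, le_div_iff₀ hpos, ← card_box_real] at h4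
        rw [← ENNReal.ofReal_natCast, ← ENNReal.ofReal_mul hδ.le,
          ← ENNReal.ofReal_sum_of_nonneg fun _ _ => norm_nonneg _]
        exact ENNReal.ofReal_le_ofReal h4
      · gcongr
    have hδ0 : ENNReal.ofReal δ * m ≠ 0 :=
      mul_ne_zero (by simpa using hδ) hne
    -- The bad set does not depend on `ε`, so letting `ε → 0` in the maximal estimate makes it null.
    have hlim : Tendsto (fun ε : ℝ => 64 * ENNReal.ofReal ε) (𝓝[>] 0) (𝓝 0) := by
      have h1 : Tendsto (fun ε : ℝ => 64 * ENNReal.ofReal ε) (𝓝 0) (𝓝 (64 * ENNReal.ofReal 0)) :=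
        ENNReal.Tendsto.const_mul (ENNReal.continuous_ofReal.tendsto 0) (.inr (by norm_num))
      simp only [ENNReal.ofReal_zero, mul_zero] at h1
      exact h1.mono_left nhdsWithin_le_nhds
    have h2 : ENNReal.ofReal δ * m ≤ 0 := by
      refine ge_of_tendsto hlim ?_
      filter_upwards [Ioo_mem_nhdsGT hδ] with ε hε using hle ε hε.1 hε.2
    exact hδ0 (le_antisymm h2 zero_le)
  have key2 : ∀ᵐ s, ∀ k : ℕ, ∀ᶠ N in atTop,
      dist (boxAverage (fun n => f (s + φ n)) N) (∫ t, f t) < 3 * (1 / ((k : ℝ) + 1)) :=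
    ae_all_iff.2 fun k => key _ (by positivity)
  filter_upwards [key2] with s hs
  rw [Metric.tendsto_nhds]
  intro ε hε
  obtain ⟨k, hk⟩ := exists_nat_one_div_lt (show 0 < ε / 3 by positivity)
  filter_upwards [hs k] with N hN
  linarith

/-- The pointwise ergodic theorem with a parameter, on which the translations act trivially. -/
theorem ae_integrable_and_tendsto_boxAverage {φ : (Fin 2 → ℤ) →+ Torus} (hφ : Nonresonant φ)
    {Y : Type*} [MeasurableSpace Y] {ν : Measure Y} [SFinite ν]
    {K : Torus × Y → ℝ} (hK : Integrable K (volume.prod ν)) :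
    ∀ᵐ p : Torus × Y ∂volume.prod ν, Integrable (fun t => K (t, p.2)) ∧
      Tendsto (boxAverage fun n => K (p.1 + φ n, p.2)) atTop (𝓝 (∫ t, K (t, p.2))) := by
  obtain ⟨K', hK'm, hKK'⟩ := hK.aestronglyMeasurable
  have hK' : Integrable K' (volume.prod ν) := hK.congr hKK'
  have hswap : MeasurePreserving (Prod.swap : Y × Torus → Torus × Y) (ν.prod volume)
      (volume.prod ν) := Measure.measurePreserving_swap
  have hswap' : MeasurePreserving (Prod.swap : Torus × Y → Y × Torus) (volume.prod ν)
      (ν.prod volume) := Measure.measurePreserving_swap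
  have hsnd : Measure.QuasiMeasurePreserving (Prod.snd : Torus × Y → Y) (volume.prod ν) ν :=
    Measure.quasiMeasurePreserving_snd
  have h1 : ∀ᵐ p ∂(volume : Measure Torus).prod ν,
      (fun t => K (t, p.2)) =ᵐ[volume] fun t => K' (t, p.2) :=
    hsnd.ae (Measure.ae_ae_of_ae_prod (hswap.quasiMeasurePreserving.ae hKK'))
  have h2 : ∀ᵐ p ∂(volume : Measure Torus).prod ν,
      ∀ n, K (p.1 + φ n, p.2) = K' (p.1 + φ n, p.2) := by
    refine ae_all_iff.2 fun n => ?_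
    have hmp := (measurePreserving_torus_add (φ n)).prod (MeasurePreserving.id ν)
    exact hmp.quasiMeasurePreserving.ae hKK'
  have h3 : ∀ᵐ c ∂ν, Integrable (fun t => K' (t, c)) := hK'.prod_left_ae
  have hlim : StronglyMeasurable fun c : Y => ∫ t : Torus, K' (t, c) :=
    StronglyMeasurable.integral_prod_left' hK'm
  let Q : Torus × Y → Prop := fun p =>
    Tendsto (boxAverage fun n => K' (p.1 + φ n, p.2)) atTop (𝓝 (∫ t, K' (t, p.2)))
  -- Assembling almost-everywhere statements on slices into one on the product requires a measurable
  -- set, hence the strongly measurable representative `K'`.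
  have hms : MeasurableSet {p | Q p} := by
    refine measurableSet_tendsto_fun (fun N => ?_) (hlim.measurable.comp measurable_snd)
    have hn : ∀ n, Measurable fun p : Torus × Y => K' (p.1 + φ n, p.2) := fun n =>
      hK'm.measurable.comp (((measurePreserving_torus_add (φ n)).measurable.comp
        measurable_fst).prodMk measurable_snd)
    have hsum : Measurable fun p : Torus × Y => ∑ n ∈ box N, K' (p.1 + φ n, p.2) :=
      Finset.measurable_sum _ fun n _ => hn n
    exact hsum.const_mul ((2 * (N : ℝ) + 1) ^ 2)⁻¹
  -- The factors are swapped so that the outer variable of the slicing is the parameter `c`.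
  have hsw : ∀ᵐ p ∂ν.prod (volume : Measure Torus), Q p.swap := by
    refine (Measure.ae_prod_iff_ae_ae (measurable_swap hms)).2 ?_
    filter_upwards [h3] with c hc
    have hKc : StronglyMeasurable fun t => K' (t, c) := hK'm.comp_measurable measurable_prodMk_right
    exact ae_tendsto_boxAverage_of_stronglyMeasurable (f := fun t => K' (t, c)) hφ hKc hc
  have h4 : ∀ᵐ p ∂(volume : Measure Torus).prod ν, Q p :=
    hswap'.quasiMeasurePreserving.ae (p := fun p => Q p.swap) hsw
  have h5 : ∀ᵐ p ∂(volume : Measure Torus).prod ν, Integrable (fun t => K' (t, p.2)) :=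
    hsnd.ae h3
  filter_upwards [h1, h2, h5, h4] with p hp1 hp2 hp3 hp4
  refine ⟨hp3.congr hp1.symm, ?_⟩
  rw [integral_congr_ae hp1]
  simpa only [hp2] using hp4

/-- The pointwise ergodic theorem for an integrable function on the torus. -/
theorem ae_tendsto_boxAverage {φ : (Fin 2 → ℤ) →+ Torus} (hφ : Nonresonant φ)
    {f : Torus → ℝ} (hf : Integrable f) :
    ∀ᵐ s, Tendsto (boxAverage fun n => f (s + φ n)) atTop (𝓝 (∫ t, f t)) := by
  obtain ⟨f', hf'm, hff'⟩ := hf.aestronglyMeasurable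
  have h : ∀ᵐ s, ∀ n, f (s + φ n) = f' (s + φ n) := ae_all_iff.2 fun n =>
    (measurePreserving_torus_add (φ n)).quasiMeasurePreserving.ae hff'
  filter_upwards [h, ae_tendsto_boxAverage_of_stronglyMeasurable hφ hf'm (hf.congr hff')]
    with s hs1 hs2
  rw [integral_congr_ae hff']
  simpa only [hs1] using hs2

/-! ### Linear maps of the plane -/

lemma act_apply (M : Mat2) (x : E2) (i : Fin 2) : act M x i = ∑ j, M i j * x j := rfl

lemma act_mul (M N : Mat2) (x : E2) : act (M * N) x = act M (act N x) := by
  simp [act, Matrix.toEuclideanLin]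

lemma act_one (x : E2) : act 1 x = x := by
  simp [act, Matrix.toEuclideanLin]

lemma act_add (M : Mat2) (x y : E2) : act M (x + y) = act M x + act M y := map_add _ _ _

lemma act_sub (M : Mat2) (x y : E2) : act M (x - y) = act M x - act M y := map_sub _ _ _

lemma act_zero (M : Mat2) : act M 0 = 0 := map_zero _

lemma sub_act (M N : Mat2) (x : E2) : act (M - N) x = act M x - act N x := by
  simp [act, map_sub]

lemma act_inv_act {M : Mat2} (hM : M.det ≠ 0) (x : E2) : act M⁻¹ (act M x) = x := by
  rw [← act_mul, Matrix.nonsing_inv_mul _ (isUnit_iff_ne_zero.2 hM), act_one]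

lemma act_act_inv {M : Mat2} (hM : M.det ≠ 0) (x : E2) : act M (act M⁻¹ x) = x := by
  rw [← act_mul, Matrix.mul_nonsing_inv _ (isUnit_iff_ne_zero.2 hM), act_one]

lemma continuous_act (M : Mat2) : Continuous (act M) :=
  LinearMap.continuous_of_finiteDimensional _

lemma measurable_act (M : Mat2) : Measurable (act M) := (continuous_act M).measurable

lemma det_inv_ne_zero {M : Mat2} (hM : M.det ≠ 0) : M⁻¹.det ≠ 0 := by
  rw [Matrix.det_nonsing_inv, Ring.inverse_eq_inv']
  exact inv_ne_zero hM

lemma map_act_volume {M : Mat2} (hM : M.det ≠ 0) :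
    ∃ c : ℝ≥0∞, c ≠ 0 ∧ Measure.map (act M) volume = c • volume := by
  have hdet : LinearMap.det (Matrix.toEuclideanLin M) = M.det := by
    rw [Matrix.toEuclideanLin, LinearMap.det_toLpLin]
  refine ⟨_, ?_, Measure.map_linearMap_addHaar_eq_smul_addHaar volume
    (f := Matrix.toEuclideanLin M) (by rwa [hdet])⟩
  rw [hdet]
  simpa using hM

lemma quasiMeasurePreserving_act {M : Mat2} (hM : M.det ≠ 0) :
    Measure.QuasiMeasurePreserving (act M) volume volume := by
  obtain ⟨c, -, hc⟩ := map_act_volume hM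
  refine ⟨measurable_act M, ?_⟩
  rw [hc]
  exact Measure.smul_absolutelyContinuous

lemma latticePoint_add (M : Mat2) (m n : Fin 2 → ℤ) :
    latticePoint M (m + n) = latticePoint M m + latticePoint M n := by
  rw [latticePoint, latticePoint, latticePoint, ← act_add]
  congr 1
  ext i
  simp

lemma latticePoint_zero (M : Mat2) : latticePoint M 0 = 0 := by
  have h : (WithLp.toLp 2 fun i => (((0 : Fin 2 → ℤ) i : ℤ) : ℝ)) = (0 : E2) := by ext i; simp
  rw [latticePoint, h, act_zero]

lemma latticePoint_neg (M : Mat2) (n : Fin 2 → ℤ) :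
    latticePoint M (-n) = -latticePoint M n := by
  rw [eq_neg_iff_add_eq_zero, ← latticePoint_add, neg_add_cancel, latticePoint_zero]

lemma latticePoint_mem (M : Mat2) (n : Fin 2 → ℤ) : latticePoint M n ∈ lattice M := ⟨n, rfl⟩

lemma act_latticePoint (M N : Mat2) (n : Fin 2 → ℤ) :
    act M (latticePoint N n) = latticePoint (M * N) n := (act_mul M N _).symm

lemma cell_eq_preimage {M : Mat2} (hM : M.det ≠ 0) :
    cell M = act M⁻¹ ⁻¹' {t | ∀ i, t i ∈ Set.Ico (0 : ℝ) 1} := by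
  ext x
  constructor
  · rintro ⟨t, ht, rfl⟩
    rwa [Set.mem_preimage, act_inv_act hM]
  · intro hx
    exact ⟨_, hx, act_act_inv hM x⟩

lemma measurableSet_unitCube : MeasurableSet {t : E2 | ∀ i, t i ∈ Set.Ico (0 : ℝ) 1} := by
  have h : {t : E2 | ∀ i, t i ∈ Set.Ico (0 : ℝ) 1} =
      ⋂ i, (fun t : E2 => t i) ⁻¹' Set.Ico 0 1 := by
    ext t
    simp
  rw [h]
  exact .iInter fun i => (by fun_prop : Measurable fun t : E2 => t i) measurableSet_Ico

lemma measurableSet_cell {M : Mat2} (hM : M.det ≠ 0) : MeasurableSet (cell M) := by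
  rw [cell_eq_preimage hM]
  exact measurable_act _ measurableSet_unitCube

lemma act_image_cell (M N : Mat2) : act M '' cell N = cell (M * N) := by
  rw [cell, cell, Set.image_image]
  simp only [act_mul]

/-! ### The torus and the plane -/

/-- The quotient map of the plane onto the torus of the lattice `P ℤ²`. -/
def toTorus (P : Mat2) : E2 →+ Torus where
  toFun x := fun i => ((act P⁻¹ x i : ℝ) : UnitAddCircle)
  map_zero' := by ext i; simp [act_zero]
  map_add' x y := by ext i; simp [act_add]

lemma toTorus_apply (P : Mat2) (x : E2) (i : Fin 2) :
    toTorus P x i = ((act P⁻¹ x i : ℝ) : UnitAddCircle) := rfl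

/-- The section of `toTorus P` with values in the unit cell. -/
def fromTorus (P : Mat2) (s : Torus) : E2 :=
  act P (WithLp.toLp 2 fun i => (AddCircle.equivIco 1 0 (s i) : ℝ))

lemma toTorus_fromTorus {P : Mat2} (hP : P.det ≠ 0) (s : Torus) :
    toTorus P (fromTorus P s) = s := by
  ext i
  rw [toTorus_apply, fromTorus, act_inv_act hP]
  exact AddCircle.coe_equivIco

lemma measurable_toTorus (P : Mat2) : Measurable (toTorus P) := by
  refine measurable_pi_lambda _ fun i => ?_
  exact AddCircle.measurable_mk'.comp
    ((by fun_prop : Measurable fun t : E2 => t i).comp (measurable_act P⁻¹))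

lemma toTorus_latticePoint {P : Mat2} (hP : P.det ≠ 0) (n : Fin 2 → ℤ) :
    toTorus P (latticePoint P n) = 0 := by
  ext i
  rw [toTorus_apply, latticePoint, act_inv_act hP, Pi.zero_apply]
  exact (AddCircle.coe_eq_zero_iff 1).2 ⟨n i, by simp⟩

lemma exists_latticePoint_of_toTorus_eq {P : Mat2} (hP : P.det ≠ 0) {x y : E2}
    (h : toTorus P x = toTorus P y) : ∃ n, x = y + latticePoint P n := by
  have h0 : toTorus P (x - y) = 0 := by rw [map_sub, h, sub_self]
  have hi : ∀ i, ∃ m : ℤ, (m : ℝ) = act P⁻¹ (x - y) i := fun i => by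
    have := congrFun h0 i
    rw [toTorus_apply, Pi.zero_apply, AddCircle.coe_eq_zero_iff] at this
    simpa using this
  choose n hn using hi
  refine ⟨n, ?_⟩
  rw [latticePoint]
  have : (WithLp.toLp 2 fun i => (n i : ℝ)) = act P⁻¹ (x - y) := by
    ext i
    exact hn i
  rw [this, act_act_inv hP]
  abel

/-- This lets `f ∘ fromTorus P` serve as the descent of a periodic function to the torus. -/
lemma eq_of_toTorus_eq {P : Mat2} (hP : P.det ≠ 0) {Z : Type*} {f : E2 → Z}
    (hf : ∀ n x, f (x + latticePoint P n) = f x) {x y : E2} (h : toTorus P x = toTorus P y) :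
    f x = f y := by
  obtain ⟨n, rfl⟩ := exists_latticePoint_of_toTorus_eq hP h
  exact hf n y

lemma measurePreserving_equivIco_val :
    MeasurePreserving (fun x : UnitAddCircle => (AddCircle.equivIco 1 0 x : ℝ)) volume
      (volume.restrict (Set.Ico 0 1)) := by
  have hmeas : Measurable fun x : UnitAddCircle => (AddCircle.equivIco 1 0 x : ℝ) :=
    measurable_subtype_coe.comp (AddCircle.measurableEquivIco 1 0).measurable
  refine ⟨hmeas, ?_⟩
  have hmk := UnitAddCircle.measurePreserving_mk 0
  rw [zero_add, Measure.restrict_congr_set (Ico_ae_eq_Ioc (μ := (volume : Measure ℝ))).symm] at hmk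
  rw [← hmk.map_eq, Measure.map_map hmeas hmk.measurable]
  have h : ((fun x : UnitAddCircle => (AddCircle.equivIco 1 0 x : ℝ)) ∘ fun y : ℝ => (y : UnitAddCircle))
      =ᵐ[volume.restrict (Set.Ico (0 : ℝ) 1)] id := by
    filter_upwards [ae_restrict_mem measurableSet_Ico] with y hy
    have hy' : y ∈ Set.Ico (0 : ℝ) (0 + 1) := by simpa using hy
    rw [Function.comp_apply, AddCircle.equivIco_coe_eq hy', id]
  rw [Measure.map_congr h, Measure.map_id]

/-- The section is a product of circle sections followed by a linear map, so it carries Haar measure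
to a constant multiple of area on the cell. -/
lemma measurePreserving_fromTorus {P : Mat2} (hP : P.det ≠ 0) :
    MeasurePreserving (fromTorus P) volume
      ((volume.restrict (cell P) Set.univ)⁻¹ • volume.restrict (cell P)) := by
  obtain ⟨c, -, hc⟩ := map_act_volume hP
  have h1 : MeasurePreserving (fun (s : Torus) i => (AddCircle.equivIco 1 0 (s i) : ℝ)) volume
      (volume.restrict (Set.univ.pi fun _ => Set.Ico 0 1)) := by
    have := measurePreserving_pi (fun _ : Fin 2 => (volume : Measure UnitAddCircle))
      (fun _ : Fin 2 => (volume : Measure ℝ).restrict (Set.Ico 0 1))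
      (fun _ => measurePreserving_equivIco_val)
    rwa [← Measure.restrict_pi_pi] at this
  have h2 := (PiLp.volume_preserving_toLp (Fin 2)).restrict_preimage measurableSet_unitCube
  have h3 : MeasurePreserving (act P) volume (c • volume) := ⟨measurable_act P, hc⟩
  have h4 := h3.restrict_preimage (measurableSet_cell hP)
  have e1 : (WithLp.toLp 2 ⁻¹' {t : E2 | ∀ i, t i ∈ Set.Ico (0 : ℝ) 1}) =
      Set.univ.pi fun _ => Set.Ico (0 : ℝ) 1 := by
    ext t
    simp [Set.mem_pi]
  have e2 : act P ⁻¹' cell P = {t : E2 | ∀ i, t i ∈ Set.Ico (0 : ℝ) 1} := by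
    ext t
    rw [cell_eq_preimage hP, Set.mem_preimage, Set.mem_preimage, act_inv_act hP]
  rw [e1] at h2
  rw [e2, Measure.restrict_smul] at h4
  have h5 : MeasurePreserving (fromTorus P) volume (c • volume.restrict (cell P)) :=
    h4.comp (h2.comp h1)
  -- Total mass one identifies the constant as the inverse of the cell area, without computing a
  -- determinant.
  have hone := h5.measure_preimage MeasurableSet.univ.nullMeasurableSet
  rw [Set.preimage_univ, measure_univ, Measure.smul_apply, smul_eq_mul] at hone
  rw [← ENNReal.eq_inv_of_mul_eq_one_left hone.symm]
  exact h5

lemma measurableEmbedding_fromTorus {P : Mat2} (hP : P.det ≠ 0) :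
    MeasurableEmbedding (fromTorus P) :=
  (measurePreserving_fromTorus hP).measurable.measurableEmbedding
    (Function.LeftInverse.injective (toTorus_fromTorus hP))

lemma volume_cell_ne_zero_ne_top {P : Mat2} (hP : P.det ≠ 0) :
    volume (cell P) ≠ 0 ∧ volume (cell P) ≠ ∞ := by
  have hone := (measurePreserving_fromTorus hP).measure_preimage MeasurableSet.univ.nullMeasurableSet
  rw [Set.preimage_univ, measure_univ, Measure.smul_apply, smul_eq_mul,
    Measure.restrict_apply_univ] at hone
  constructor
  · intro h
    simp [h] at hone
  · intro h
    simp [h] at hone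

/-- No regularity of `f` is needed, because the section is a measurable embedding. -/
lemma setAverage_cell {P : Mat2} (hP : P.det ≠ 0) (f : E2 → ℝ) :
    ⨍ x in cell P, f x = ∫ s, f (fromTorus P s) :=
  ((measurePreserving_fromTorus hP).integral_comp (measurableEmbedding_fromTorus hP) f).symm

lemma integrableOn_cell_iff {P : Mat2} (hP : P.det ≠ 0) (f : E2 → ℝ) :
    IntegrableOn f (cell P) ↔ Integrable fun s => f (fromTorus P s) := by
  have h := (measurePreserving_fromTorus hP).integrable_comp_emb
    (measurableEmbedding_fromTorus hP) (g := f)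
  obtain ⟨h0, ht⟩ := volume_cell_ne_zero_ne_top hP
  rw [Measure.restrict_apply_univ, integrable_smul_measure (ENNReal.inv_ne_zero.2 ht)
    (ENNReal.inv_ne_top.2 h0)] at h
  exact h.symm

/-- Needed to pull almost-everywhere statements on the torus back to the plane, where the shifts
live. -/
lemma quasiMeasurePreserving_toTorus {P : Mat2} (hP : P.det ≠ 0) :
    Measure.QuasiMeasurePreserving (toTorus P) volume volume := by
  refine ⟨measurable_toTorus P, Measure.AbsolutelyContinuous.mk fun N hN hN0 => ?_⟩
  rw [Measure.map_apply (measurable_toTorus P) hN]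
  set S := toTorus P ⁻¹' N with hS
  have hSm : MeasurableSet S := measurable_toTorus P hN
  have hcell : volume (S ∩ cell P) = 0 := by
    have h := (measurePreserving_fromTorus hP).measure_preimage hSm.nullMeasurableSet
    have he : fromTorus P ⁻¹' S = N := by
      ext s
      rw [hS, Set.mem_preimage, Set.mem_preimage, toTorus_fromTorus hP]
    rw [he, hN0, Measure.smul_apply, smul_eq_mul, Measure.restrict_apply hSm,
      Measure.restrict_apply_univ] at h
    exact (mul_eq_zero.1 h.symm).resolve_left
      (ENNReal.inv_ne_zero.2 (volume_cell_ne_zero_ne_top hP).2)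
  -- A periodic set is covered by countably many lattice translates of its part in one cell.
  have hcov : S ⊆ ⋃ n : Fin 2 → ℤ, (fun x => x + latticePoint P n) ⁻¹' (S ∩ cell P) := by
    intro x hx
    have hx' : toTorus P (fromTorus P (toTorus P x)) = toTorus P x := toTorus_fromTorus hP _
    obtain ⟨n, hn⟩ := exists_latticePoint_of_toTorus_eq hP hx'
    rw [Set.mem_iUnion]
    refine ⟨n, ?_⟩
    rw [Set.mem_preimage, ← hn]
    refine ⟨?_, ?_⟩
    · rw [hS, Set.mem_preimage, hx']
      exact hx
    · refine ⟨_, fun i => ?_, rfl⟩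
      have := (AddCircle.equivIco (1 : ℝ) 0 (toTorus P x i)).2
      simpa using this
  refine measure_mono_null hcov (measure_iUnion_null fun n => ?_)
  rw [measure_preimage_add_right, hcell]

/-- Averages of a periodic function over a translated cell. -/
lemma setAverage_cell_add {P : Mat2} (hP : P.det ≠ 0) {f : E2 → ℝ}
    (hf : ∀ n x, f (x + latticePoint P n) = f x) (a : E2) :
    ⨍ x in cell P, f (x + a) = ⨍ x in cell P, f x := by
  rw [setAverage_cell hP, setAverage_cell hP,
    ← integral_add_right_eq_self (fun s => f (fromTorus P s)) (toTorus P a)]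
  refine integral_congr_ae (.of_forall fun s => ?_)
  refine eq_of_toTorus_eq hP hf ?_
  rw [map_add, toTorus_fromTorus hP, toTorus_fromTorus hP]

/-- Change of variables in an average over the preimage of a cell. -/
lemma setAverage_act_inv_image {M P : Mat2} (hM : M.det ≠ 0) (hP : P.det ≠ 0) (f : E2 → ℝ) :
    ⨍ ξ in act M⁻¹ '' cell P, f (act M ξ) = ⨍ x in cell P, f x := by
  have hdet : (M⁻¹ * P).det ≠ 0 := by
    rw [Matrix.det_mul]
    exact mul_ne_zero (det_inv_ne_zero hM) hP
  rw [act_image_cell, setAverage_cell hdet, setAverage_cell hP]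
  refine integral_congr_ae (.of_forall fun s => ?_)
  simp only [fromTorus]
  rw [← act_mul, ← Matrix.mul_assoc, Matrix.mul_nonsing_inv _ (isUnit_iff_ne_zero.2 hM),
    Matrix.one_mul]

/-- The translations of the torus of `P ℤ²` by the points of `M ℤ²`. -/
def latticeHom (P M : Mat2) : (Fin 2 → ℤ) →+ Torus :=
  (toTorus P).comp
    { toFun := latticePoint M
      map_zero' := latticePoint_zero M
      map_add' := latticePoint_add M }

lemma latticeHom_apply (P M : Mat2) (n : Fin 2 → ℤ) :
    latticeHom P M n = toTorus P (latticePoint M n) := rfl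

/-- The pointwise ergodic theorem for a periodic function sampled on a lattice. -/
theorem ae_tendsto_boxAverage_latticePoint {P M : Mat2} (hP : P.det ≠ 0)
    (hPM : Nonresonant (latticeHom P M)) {f : E2 → ℝ}
    (hf : ∀ n x, f (x + latticePoint P n) = f x) (hfi : IntegrableOn f (cell P)) :
    ∀ᵐ x, Tendsto (boxAverage fun n => f (latticePoint M n + x)) atTop
      (𝓝 (⨍ x in cell P, f x)) := by
  rw [setAverage_cell hP]
  filter_upwards [(quasiMeasurePreserving_toTorus hP).ae
    (ae_tendsto_boxAverage hPM ((integrableOn_cell_iff hP f).1 hfi))] with x hx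
  have h : (fun n => f (latticePoint M n + x)) =
      fun n => f (fromTorus P (toTorus P x + latticeHom P M n)) := funext fun n => by
    refine eq_of_toTorus_eq hP hf ?_
    rw [toTorus_fromTorus hP, map_add, latticeHom_apply, add_comm]
  rw [h]
  exact hx

/-! ### Incommensurability -/

/-- The character pulls back to `x ↦ exp(2πi k·P⁻¹x)`, which equals one only when the phase `k·P⁻¹x`
is an integer. -/
lemma exists_int_of_torusChar_toTorus_eq_one {P : Mat2} {k : Fin 2 → ℤ} {x : E2}
    (h : torusChar k (toTorus P x) = 1) : ∃ m : ℤ, (m : ℝ) = ∑ i, (k i : ℝ) * act P⁻¹ x i := by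
  have h1 : torusChar k (toTorus P x) =
      AddCircle.toCircle (((∑ i, (k i : ℝ) * act P⁻¹ x i : ℝ)) : UnitAddCircle) := by
    change UnitAddTorus.mFourier k (toTorus P x) = _
    simp only [UnitAddTorus.mFourier, ContinuousMap.coe_mk, Fin.prod_univ_two, Fin.sum_univ_two,
      fourier_apply, toTorus_apply]
    rw [AddCircle.coe_add, AddCircle.toCircle_add, ← zsmul_eq_mul, ← zsmul_eq_mul,
      AddCircle.coe_zsmul, AddCircle.coe_zsmul]
    rfl
  rw [h1, Circle.coe_eq_one, ← AddCircle.toCircle_zero (T := 1)] at h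
  have h2 := AddCircle.injective_toCircle one_ne_zero h
  obtain ⟨m, hm⟩ := (AddCircle.coe_eq_zero_iff (1 : ℝ)).1 h2
  exact ⟨m, by simpa using hm⟩

/-! ### Incommensurate twisted layers -/

lemma latticePoint_reciprocal (M : Mat2) (n : Fin 2 → ℤ) :
    latticePoint (reciprocal M) n =
      (2 * Real.pi) • WithLp.toLp 2 (Matrix.vecMul (fun i => (n i : ℝ)) M⁻¹) := by
  ext i
  simp only [latticePoint, reciprocal, act_apply, Matrix.smul_apply, Matrix.transpose_apply,
    PiLp.smul_apply, Matrix.vecMul, dotProduct, smul_eq_mul, Finset.mul_sum]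
  refine Finset.sum_congr rfl fun a _ => by ring

lemma eq_zero_of_latticePoint_reciprocal_eq_zero {M : Mat2} (hM : M.det ≠ 0) {n : Fin 2 → ℤ}
    (h : latticePoint (reciprocal M) n = 0) : n = 0 := by
  rw [latticePoint_reciprocal, smul_eq_zero] at h
  have h1 : Matrix.vecMul (fun i => (n i : ℝ)) M⁻¹ = 0 :=
    congrArg WithLp.ofLp (h.resolve_left (by positivity))
  have h2 : Matrix.vecMul (Matrix.vecMul (fun i => (n i : ℝ)) M⁻¹) M = 0 := by
    rw [h1, Matrix.zero_vecMul]
  rw [Matrix.vecMul_vecMul, Matrix.nonsing_inv_mul _ (isUnit_iff_ne_zero.2 hM),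
    Matrix.vecMul_one] at h2
  ext i
  simpa using congrFun h2 i

/-- Reciprocal vectors are, up to `2π`, the rows `n M⁻¹`; this form of incommensurability speaks of
integer coordinates only. -/
lemma Incommensurate.eq_zero_of_vecMul_eq {M M' : Mat2} (h : Incommensurate M M')
    (hM : M.det ≠ 0) (hM' : M'.det ≠ 0) {m n : Fin 2 → ℤ}
    (hmn : Matrix.vecMul (fun i => (m i : ℝ)) M⁻¹ = Matrix.vecMul (fun i => (n i : ℝ)) M'⁻¹) :
    m = 0 ∧ n = 0 := by
  have h0 : latticePoint (reciprocal M) m + latticePoint (reciprocal M') (-n) = 0 := by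
    rw [latticePoint_neg, latticePoint_reciprocal, latticePoint_reciprocal, hmn, add_neg_cancel]
  obtain ⟨h1, h2⟩ := (h _ (latticePoint_mem _ m) _ (latticePoint_mem _ (-n))).1 h0
  exact ⟨eq_zero_of_latticePoint_reciprocal_eq_zero hM h1,
    neg_eq_zero.1 (eq_zero_of_latticePoint_reciprocal_eq_zero hM' h2)⟩

lemma det_rot (φ : ℝ) : (rot φ).det = 1 := by
  rw [rot, Matrix.det_fin_two_of]
  nlinarith [Real.sin_sq_add_cos_sq φ]

lemma det_layerMatrix_ne_zero {θ q : ℝ} (hq : 0 < q) {A : Mat2} (hA : A.det ≠ 0) (j : Fin 2) :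
    (layerMatrix θ q A j).det ≠ 0 := by
  have hs : Real.sqrt q ≠ 0 := (Real.sqrt_pos.2 hq).ne'
  fin_cases j
  · change ((Real.sqrt q)⁻¹ • (rot (-(θ / 2)) * A)).det ≠ 0
    rw [Matrix.det_smul, Matrix.det_mul, det_rot, one_mul]
    exact mul_ne_zero (pow_ne_zero _ (inv_ne_zero hs)) hA
  · change (Real.sqrt q • (rot (θ / 2) * A)).det ≠ 0
    rw [Matrix.det_smul, Matrix.det_mul, det_rot, one_mul]
    exact mul_ne_zero (pow_ne_zero _ hs) hA

/-- The moiré matrix of incommensurate twisted layers is well defined. -/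
lemma det_inv_sub_inv_ne_zero {θ q : ℝ} (hq : 0 < q) {A : Mat2} (hA : A.det ≠ 0)
    (hinc : Incommensurate (layerMatrix θ q A 0) (layerMatrix θ q A 1)) :
    ((layerMatrix θ q A 0)⁻¹ - (layerMatrix θ q A 1)⁻¹).det ≠ 0 := by
  intro hdet
  set L := layerMatrix θ q A with hL
  have h0 : (L 0).det ≠ 0 := det_layerMatrix_ne_zero hq hA 0
  have h1 : (L 1).det ≠ 0 := det_layerMatrix_ne_zero hq hA 1
  have hs : 0 < Real.sqrt q := Real.sqrt_pos.2 hq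
  set a := (Real.sqrt q - (Real.sqrt q)⁻¹) * Real.cos (θ / 2) with ha
  set b := (Real.sqrt q + (Real.sqrt q)⁻¹) * Real.sin (θ / 2) with hb
  -- The difference of two scaled rotations acts as multiplication by `a + ib`, with determinant `a²
  -- + b²`; it is singular only if it vanishes.
  have hdiff : L 1 - L 0 = !![a, -b; b, a] * A := by
    change Real.sqrt q • (rot (θ / 2) * A) - (Real.sqrt q)⁻¹ • (rot (-(θ / 2)) * A) = _
    rw [← Matrix.smul_mul, ← Matrix.smul_mul, ← Matrix.sub_mul]
    congr 1
    ext i k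
    fin_cases i <;> fin_cases k <;> simp [rot, ha, hb] <;> ring
  have hfac : L 0 * ((L 0)⁻¹ - (L 1)⁻¹) * L 1 = L 1 - L 0 := by
    rw [Matrix.mul_sub, Matrix.sub_mul, Matrix.mul_nonsing_inv _ (isUnit_iff_ne_zero.2 h0),
      Matrix.one_mul, Matrix.mul_assoc, Matrix.nonsing_inv_mul _ (isUnit_iff_ne_zero.2 h1),
      Matrix.mul_one]
  have hdet' : (L 1 - L 0).det = 0 := by
    rw [← hfac, Matrix.det_mul, Matrix.det_mul, hdet, mul_zero, zero_mul]
  rw [hdiff, Matrix.det_mul, Matrix.det_fin_two_of] at hdet'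
  have hab := (mul_eq_zero.1 hdet').resolve_right hA
  have ha0 : a = 0 := by nlinarith [sq_nonneg a, sq_nonneg b]
  have hb0 : b = 0 := by nlinarith [sq_nonneg a, sq_nonneg b]
  have hM0 : (!![a, -b; b, a] : Mat2) = 0 := by
    ext i k
    fin_cases i <;> fin_cases k <;> simp [ha0, hb0]
  rw [hM0, Matrix.zero_mul, sub_eq_zero] at hdiff
  -- The layers now coincide, so any nonzero integer vector contradicts incommensurability.
  have h10 := (hinc.eq_zero_of_vecMul_eq h0 h1 (m := fun _ => 1) (n := fun _ => 1)
    (by rw [hdiff])).1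
  exact one_ne_zero (congrFun h10 0)

/-- Incommensurability of the reciprocal lattices makes the layer lattices act ergodically on the
moiré torus. -/
lemma nonresonant_latticeHom_moireMatrix {L : Fin 2 → Mat2} (hL : ∀ j, (L j).det ≠ 0)
    (hP : ((L 0)⁻¹ - (L 1)⁻¹).det ≠ 0) (hinc : Incommensurate (L 0) (L 1)) (j : Fin 2) :
    Nonresonant (latticeHom (moireMatrix L) (L j)) := by
  intro k hk
  by_contra! hcon
  have hint : ∀ i, ∃ m : ℤ, (m : ℝ) =
      Matrix.vecMul (fun i => (k i : ℝ)) (((L 0)⁻¹ - (L 1)⁻¹) * L j) i := fun i => by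
    have h := hcon (Pi.single i 1)
    rw [latticeHom_apply] at h
    obtain ⟨m, hm⟩ := exists_int_of_torusChar_toTorus_eq_one h
    refine ⟨m, hm.trans ?_⟩
    rw [act_latticePoint, moireMatrix, Matrix.nonsing_inv_nonsing_inv _ (isUnit_iff_ne_zero.2 hP)]
    simp only [Matrix.vecMul, dotProduct]
    refine Finset.sum_congr rfl fun a _ => ?_
    congr 1
    rw [latticePoint, act_apply]
    simp [Pi.single_apply]
  choose m hm using hint
  -- Triviality on the lattice makes `m = k (A₁⁻¹ - A₂⁻¹) A_j` integral. Moving `m A_j⁻¹` to the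
  -- side of layer `j` gives the coincidence `(k - m) A₁⁻¹ = k A₂⁻¹` or `k A₁⁻¹ = (k + m) A₂⁻¹`, and
  -- `k ≠ 0`.
  have hvec : Matrix.vecMul (fun i => (m i : ℝ)) (L j)⁻¹ =
      Matrix.vecMul (fun i => (k i : ℝ)) (L 0)⁻¹ - Matrix.vecMul (fun i => (k i : ℝ)) (L 1)⁻¹ := by
    rw [funext hm, Matrix.vecMul_vecMul, Matrix.mul_assoc,
      Matrix.mul_nonsing_inv _ (isUnit_iff_ne_zero.2 (hL j)), Matrix.mul_one, Matrix.vecMul_sub]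
  fin_cases j
  · have hsub : (fun i => (((k - m) i : ℤ) : ℝ)) = (fun i => (k i : ℝ)) - fun i => (m i : ℝ) := by
      ext i; simp
    refine hk (hinc.eq_zero_of_vecMul_eq (hL 0) (hL 1) (m := k - m) (n := k) ?_).2
    rw [hsub, Matrix.sub_vecMul]
    change Matrix.vecMul _ (L 0)⁻¹ = _ at hvec
    rw [hvec]
    abel
  · have hadd : (fun i => (((k + m) i : ℤ) : ℝ)) = (fun i => (k i : ℝ)) + fun i => (m i : ℝ) := by
      ext i; simp
    refine hk (hinc.eq_zero_of_vecMul_eq (hL 0) (hL 1) (m := k) (n := k + m) ?_).1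
    rw [hadd, Matrix.add_vecMul]
    change Matrix.vecMul _ (L 1)⁻¹ = _ at hvec
    rw [hvec]
    abel

lemma det_moireMatrix_ne_zero {L : Fin 2 → Mat2} (hP : ((L 0)⁻¹ - (L 1)⁻¹).det ≠ 0) :
    (moireMatrix L).det ≠ 0 := det_inv_ne_zero hP

/-- The sign with which disregistry relates the moiré lattice to the lattice of the opposite
layer. -/
def disregistrySign : Fin 2 → ℤ := ![-1, 1]

lemma inv_mul_disregistry {L : Fin 2 → Mat2} (hL : ∀ j, (L j).det ≠ 0)
    (hP : ((L 0)⁻¹ - (L 1)⁻¹).det ≠ 0) (j : Fin 2) :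
    (L (1 - j))⁻¹ * disregistry L j = disregistrySign j • (moireMatrix L)⁻¹ := by
  rw [disregistry, Matrix.mul_sub, Matrix.mul_one, ← Matrix.mul_assoc,
    Matrix.nonsing_inv_mul _ (isUnit_iff_ne_zero.2 (hL _)), Matrix.one_mul, moireMatrix,
    Matrix.nonsing_inv_nonsing_inv _ (isUnit_iff_ne_zero.2 hP)]
  fin_cases j
  · change (L 1)⁻¹ - (L 0)⁻¹ = (-1 : ℤ) • _
    rw [neg_one_smul, neg_sub]
  · change (L 0)⁻¹ - (L 1)⁻¹ = (1 : ℤ) • _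
    rw [one_smul]

/-- In lattice coordinates disregistry is `±1`, because `A_{3-j}⁻¹ (1 - A_{3-j} A_j⁻¹) = A_{3-j}⁻¹ -
A_j⁻¹ = ±A_ℳ⁻¹`. -/
lemma toTorus_disregistry {L : Fin 2 → Mat2} (hL : ∀ j, (L j).det ≠ 0)
    (hP : ((L 0)⁻¹ - (L 1)⁻¹).det ≠ 0) (j : Fin 2) (x : E2) :
    toTorus (L (1 - j)) (act (disregistry L j) x) =
      disregistrySign j • toTorus (moireMatrix L) x := by
  ext i
  rw [toTorus_apply, ← act_mul, inv_mul_disregistry hL hP, Pi.smul_apply, toTorus_apply,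
    ← AddCircle.coe_zsmul]
  have h : act (disregistrySign j • (moireMatrix L)⁻¹) x =
      disregistrySign j • act (moireMatrix L)⁻¹ x := by
    rw [act, act, map_zsmul]
    rfl
  rw [h]
  rfl

lemma act_disregistry {L : Fin 2 → Mat2} (j : Fin 2) (x : E2) :
    act (disregistry L j) x = x - act (L (1 - j) * (L j)⁻¹) x := by
  rw [disregistry, sub_act, act_one]

/-! ### Monolayer energies -/

section Mono

variable {S : Type*} [Fintype S]

lemma monoEnergyN_eq_boxAverage (M : Mat2) (V : S → (lattice M × S → E3) → ℝ) (u : S → E2 → E3)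
    (γ : E2) :
    monoEnergyN M V u γ = boxAverage fun n => monoSite M V u (latticePoint M n + γ) := by
  ext N
  simp only [monoEnergyN, boxAverage, monoSite]
  rw [← Finset.mul_sum, Finset.sum_comm, smul_eq_mul, mul_inv]
  ring

lemma monoEnergy_eq_setAverage {M P : Mat2} (hM : M.det ≠ 0) (hP : P.det ≠ 0)
    (V : S → (lattice M × S → E3) → ℝ) (u : S → E2 → E3) :
    monoEnergy P M V u = ⨍ x in cell P, monoSite M V u x := by
  rw [monoEnergy, setAverage_act_inv_image hM hP fun x => ∑ α, V α (monoStencil M u α x)]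
  simp only [monoSite, average]
  rw [integral_const_mul]

lemma monoSite_add_latticePoint {M P : Mat2} (V : S → (lattice M × S → E3) → ℝ) {u : S → E2 → E3}
    (hu : ∀ α, ∀ R ∈ lattice P, ∀ x, u α (x + R) = u α x) (n : Fin 2 → ℤ) (x : E2) :
    monoSite M V u (x + latticePoint P n) = monoSite M V u x := by
  simp only [monoSite]
  congr 1
  refine Finset.sum_congr rfl fun α _ => ?_
  congr 1
  ext1 p
  change u p.2 (x + latticePoint P n + p.1) - u α (x + latticePoint P n) =
    u p.2 (x + p.1) - u α x
  rw [add_right_comm, hu _ _ (latticePoint_mem P n), hu _ _ (latticePoint_mem P n)]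

end Mono

/-! ### Interlayer energies -/

section Inter

variable {𝒜 : Fin 2 → Type*} [∀ k, Fintype (𝒜 k)]
  {L : Fin 2 → Mat2} {τ : ∀ k, 𝒜 k → E2} {j : Fin 2}
  {V : 𝒜 j → InterConfig 𝒜 L j → ℝ} {u : ∀ k, 𝒜 k → E2 → E3}

lemma embed_sub (x y : E2) : embed (x - y) = embed x - embed y := by
  ext i
  fin_cases i <;> simp [embed]

/-- The stencil of the generalized site potential. -/
lemma interStencil_sub {𝒜 : Fin 2 → Type*} {L : Fin 2 → Mat2} {τ : ∀ k, 𝒜 k → E2} {j : Fin 2}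
    {u : ∀ k, 𝒜 k → E2 → E3} (α : 𝒜 j) (x y : E2) :
    interStencil L τ u j α x (x - y) = fun p =>
      embed (y - p.1 + τ j α - τ (1 - j) p.2) + u j α x - u (1 - j) p.2 (x - y + p.1) := by
  ext1 p
  have h : y - (p.1 : E2) + τ j α - τ (1 - j) p.2 = (x + τ j α) - (x - y + p.1 + τ (1 - j) p.2) := by
    abel
  rw [h, embed_sub]
  simp only [interStencil, position]
  abel

lemma interSite_eq (x y : E2) :
    interSite L τ j V u x y =
      (cellArea (L j))⁻¹ * ∑ α, V α (interStencil L τ u j α x (x - y)) := by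
  simp only [interStencil_sub]
  rfl

/-- The second argument of the generalized potential is the relative position `x - z` of a site `x`
and a base point `z` of the opposite layer. -/
lemma interSite_sub (x z : E2) :
    interSite L τ j V u x (x - z) =
      (cellArea (L j))⁻¹ * ∑ α, V α (interStencil L τ u j α x z) := by
  rw [interSite_eq]
  simp only [sub_sub_cancel]

lemma interSite_add_moire (hu : ∀ k α, MoirePeriodic L (u k α)) (n : Fin 2 → ℤ) (x y : E2) :
    interSite L τ j V u (x + latticePoint (moireMatrix L) n) y = interSite L τ j V u x y := by
  simp only [interSite]
  congr 1
  refine Finset.sum_congr rfl fun α _ => ?_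
  congr 1
  ext1 p
  have h : x + latticePoint (moireMatrix L) n - y + p.1 =
      x - y + p.1 + latticePoint (moireMatrix L) n := by abel
  rw [h, hu _ _ _ (latticePoint_mem _ n), hu _ _ _ (latticePoint_mem _ n)]

/-- A lattice shift of `y` only relabels the sites `R'` of the opposite layer, which translation
invariance ignores. -/
lemma interSite_add_latticePoint (hV : ∀ α, TranslationInvariant (V α)) (n : Fin 2 → ℤ)
    (x y : E2) :
    interSite L τ j V u x (y + latticePoint (L (1 - j)) n) = interSite L τ j V u x y := by
  simp only [interSite]
  congr 1
  refine Finset.sum_congr rfl fun α _ => ?_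
  rw [← hV α (fun p => embed (y - p.1 + τ j α - τ (1 - j) p.2) + u j α x -
    u (1 - j) p.2 (x - y + p.1)) (-⟨_, latticePoint_mem (L (1 - j)) n⟩)]
  congr 1
  ext1 p
  have h1 : y + latticePoint (L (1 - j)) n - p.1 = y - (p.1 + -latticePoint (L (1 - j)) n) := by
    abel
  have h2 : x - (y + latticePoint (L (1 - j)) n) + p.1 =
      x - y + (p.1 + -latticePoint (L (1 - j)) n) := by abel
  rw [h1, h2]
  rfl

lemma interSiteDiag_eq (γ : Fin 2 → E2) (x : E2) :
    interSiteDiag L τ j V u γ x = interSite L τ j V u x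
      (x - (act (L (1 - j) * (L j)⁻¹) (x - γ j) + γ (1 - j))) := by
  rw [interSiteDiag, act_disregistry, act_sub]
  congr 1
  abel

/-- At `x = A_j n + γ_j` the diagonal pairs `x` with the base point `A_{3-j} n + γ_{3-j}` instead of
`γ_{3-j}`; the two differ by a lattice vector of the opposite layer. -/
lemma interEnergyN_eq_boxAverage (hL : ∀ j, (L j).det ≠ 0)
    (hV : ∀ α, TranslationInvariant (V α)) (γ : Fin 2 → E2) :
    interEnergyN L τ j V u γ = boxAverage fun n =>
      interSiteDiag L τ j V u γ (latticePoint (L j) n + γ j) := by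
  ext N
  simp only [interEnergyN, boxAverage]
  rw [mul_inv, mul_comm (cellArea (L j))⁻¹, mul_assoc, Finset.mul_sum, smul_eq_mul]
  congr 1
  refine Finset.sum_congr rfl fun n _ => ?_
  rw [← interSite_sub, interSiteDiag_eq, add_sub_cancel_right, act_latticePoint, Matrix.mul_assoc,
    Matrix.nonsing_inv_mul _ (isUnit_iff_ne_zero.2 (hL j)), Matrix.mul_one,
    ← interSite_add_latticePoint hV n _ (_ - (_ + _))]
  congr 1
  abel

lemma interSiteDiag_act (hL : ∀ j, (L j).det ≠ 0) (γ : Fin 2 → E2) (ξ : E2) :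
    interSiteDiag L τ j V u γ (act (L j) ξ + γ j) = (cellArea (L j))⁻¹ * ∑ α,
      V α (interStencil L τ u j α (act (L j) ξ + γ j) (act (L (1 - j)) ξ + γ (1 - j))) := by
  rw [← interSite_sub, interSiteDiag_eq, add_sub_cancel_right, ← act_mul, Matrix.mul_assoc,
    Matrix.nonsing_inv_mul _ (isUnit_iff_ne_zero.2 (hL j)), Matrix.mul_one]

/-- The function on the product of the moiré torus and the torus of the opposite layer that the
generalized site potential descends to. -/
def torusSite (L : Fin 2 → Mat2) (τ : ∀ k, 𝒜 k → E2) (j : Fin 2)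
    (V : 𝒜 j → InterConfig 𝒜 L j → ℝ) (u : ∀ k, 𝒜 k → E2 → E3) (p : Torus × Torus) : ℝ :=
  interSite L τ j V u (fromTorus (moireMatrix L) p.1) (fromTorus (L (1 - j)) p.2)

lemma interSite_eq_torusSite (hL : ∀ j, (L j).det ≠ 0) (hP : (moireMatrix L).det ≠ 0)
    (hu : ∀ k α, MoirePeriodic L (u k α)) (hV : ∀ α, TranslationInvariant (V α)) (x y : E2) :
    interSite L τ j V u x y =
      torusSite L τ j V u (toTorus (moireMatrix L) x, toTorus (L (1 - j)) y) := by
  rw [torusSite]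
  rw [eq_of_toTorus_eq hP (f := fun x => interSite L τ j V u x y)
    (fun n x => interSite_add_moire hu n x y) (toTorus_fromTorus hP _).symm]
  exact eq_of_toTorus_eq (hL (1 - j)) (f := fun y => interSite L τ j V u _ y)
    (fun n y => interSite_add_latticePoint hV n _ y) (toTorus_fromTorus (hL (1 - j)) _).symm

/-- The offset of the diagonal on which the site potential is sampled. -/
def diagOffset (L : Fin 2 → Mat2) (j : Fin 2) (γ : Fin 2 → E2) : E2 :=
  act (L (1 - j) * (L j)⁻¹) (γ j) - γ (1 - j)

lemma interSiteDiag_eq_torusSite (hL : ∀ j, (L j).det ≠ 0)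
    (hP : ((L 0)⁻¹ - (L 1)⁻¹).det ≠ 0)
    (hu : ∀ k α, MoirePeriodic L (u k α)) (hV : ∀ α, TranslationInvariant (V α))
    (γ : Fin 2 → E2) (x : E2) :
    interSiteDiag L τ j V u γ x =
      torusSite L τ j V u (toTorus (moireMatrix L) x,
        disregistrySign j • toTorus (moireMatrix L) x +
          toTorus (L (1 - j)) (diagOffset L j γ)) := by
  rw [interSiteDiag, add_sub_assoc, interSite_eq_torusSite hL (det_moireMatrix_ne_zero hP) hu hV,
    map_add, toTorus_disregistry hL hP]
  rfl

lemma interSiteDiag_add_moire (hL : ∀ j, (L j).det ≠ 0)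
    (hP : ((L 0)⁻¹ - (L 1)⁻¹).det ≠ 0)
    (hu : ∀ k α, MoirePeriodic L (u k α)) (hV : ∀ α, TranslationInvariant (V α))
    (γ : Fin 2 → E2) (n : Fin 2 → ℤ) (x : E2) :
    interSiteDiag L τ j V u γ (x + latticePoint (moireMatrix L) n) =
      interSiteDiag L τ j V u γ x := by
  rw [interSiteDiag_eq_torusSite hL hP hu hV, interSiteDiag_eq_torusSite hL hP hu hV, map_add,
    toTorus_latticePoint (det_moireMatrix_ne_zero hP), add_zero]

lemma interEnergy_eq_setAverage (hL : ∀ j, (L j).det ≠ 0)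
    (hP : ((L 0)⁻¹ - (L 1)⁻¹).det ≠ 0)
    (hu : ∀ k α, MoirePeriodic L (u k α)) (hV : ∀ α, TranslationInvariant (V α))
    (γ : Fin 2 → E2) :
    interEnergy L τ j V u γ =
      ⨍ x in cell (moireMatrix L), interSiteDiag L τ j V u γ x := by
  have hP' := det_moireMatrix_ne_zero hP
  rw [← setAverage_cell_add hP' (interSiteDiag_add_moire hL hP hu hV γ) (γ j),
    ← setAverage_act_inv_image (hL j) hP', interEnergy]
  simp only [interSiteDiag_act hL, average]
  rw [integral_const_mul]

/-! ### The product of the two tori, its shear, and the shifts. -/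

lemma integrableOn_cell_prod_iff {P Q : Mat2} (hP : P.det ≠ 0) (hQ : Q.det ≠ 0)
    (f : E2 × E2 → ℝ) :
    IntegrableOn f (cell P ×ˢ cell Q) ↔
      Integrable fun p : Torus × Torus => f (fromTorus P p.1, fromTorus Q p.2) := by
  obtain ⟨hP0, hPt⟩ := volume_cell_ne_zero_ne_top hP
  obtain ⟨hQ0, hQt⟩ := volume_cell_ne_zero_ne_top hQ
  have hmp := (measurePreserving_fromTorus hP).prod (measurePreserving_fromTorus hQ)
  rw [Measure.prod_smul_left, Measure.prod_smul_right, Measure.prod_restrict,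
    Measure.restrict_apply_univ, Measure.restrict_apply_univ] at hmp
  have h := hmp.integrable_comp_emb ((measurableEmbedding_fromTorus hP).prodMap
    (measurableEmbedding_fromTorus hQ)) (g := f)
  rw [integrable_smul_measure (ENNReal.inv_ne_zero.2 hPt) (ENNReal.inv_ne_top.2 hP0),
    integrable_smul_measure (ENNReal.inv_ne_zero.2 hQt) (ENNReal.inv_ne_top.2 hQ0)] at h
  exact h.symm

/-- Each fibre is translated by `m • p.1`. With `m` the disregistry sign, the shear turns slices of
fixed second coordinate into the diagonals on which the layer is sampled. -/
lemma measurePreserving_torus_shear (m : ℤ) :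
    MeasurePreserving (fun p : Torus × Torus => (p.1, m • p.1 + p.2)) volume volume := by
  have hm : Measurable fun p : Torus × Torus => m • p.1 + p.2 :=
    (by fun_prop : Continuous fun p : Torus × Torus => m • p.1 + p.2).measurable
  exact (MeasurePreserving.id (volume : Measure Torus)).skew_product (g := fun a b => m • a + b)
    hm (.of_forall fun a => (measurePreserving_add_left volume (m • a)).map_eq)

lemma measurePreserving_pair (j : Fin 2) :
    MeasurePreserving (fun γ : Fin 2 → E2 => (γ j, γ (1 - j))) volume volume := by
  have h := volume_preserving_piFinTwo fun _ : Fin 2 => E2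
  fin_cases j
  · exact h
  · exact Measure.measurePreserving_swap.comp h

/-- The two shifts supply independently the starting point of the orbit and the offset of the
diagonal, up to a measure-preserving shear of the plane variables. -/
lemma quasiMeasurePreserving_shift_offset (hL : ∀ j, (L j).det ≠ 0)
    (hP : (moireMatrix L).det ≠ 0) (j : Fin 2) :
    Measure.QuasiMeasurePreserving (fun γ : Fin 2 → E2 =>
      (toTorus (moireMatrix L) (γ j), toTorus (L (1 - j)) (diagOffset L j γ)))
      volume volume := by
  have hm : Measurable fun p : E2 × E2 => act (L (1 - j) * (L j)⁻¹) p.1 - p.2 :=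
    ((measurable_act _).comp measurable_fst).sub measurable_snd
  have h1 : MeasurePreserving (fun p : E2 × E2 => (p.1, act (L (1 - j) * (L j)⁻¹) p.1 - p.2))
      volume volume :=
    (MeasurePreserving.id (volume : Measure E2)).skew_product
      (g := fun a b => act (L (1 - j) * (L j)⁻¹) a - b) hm
      (.of_forall fun a => (Measure.measurePreserving_sub_left volume _).map_eq)
  exact (QuasiMeasurePreserving.prodMap (quasiMeasurePreserving_toTorus hP)
    (quasiMeasurePreserving_toTorus (hL (1 - j)))).comp
      (h1.comp (measurePreserving_pair j)).quasiMeasurePreserving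

/-- The interlayer energies of translation-invariant potentials converge for almost all shifts. -/
theorem ae_integrableOn_and_tendsto_interEnergyN (hL : ∀ j, (L j).det ≠ 0)
    (hP : ((L 0)⁻¹ - (L 1)⁻¹).det ≠ 0) (hinc : Incommensurate (L 0) (L 1))
    (hu : ∀ k α, MoirePeriodic L (u k α)) (hV : ∀ α, TranslationInvariant (V α))
    (hint : IntegrableOn (fun p : E2 × E2 => interSite L τ j V u p.1 p.2)
      (cell (moireMatrix L) ×ˢ cell (L (1 - j)))) :
    ∀ᵐ γ : Fin 2 → E2, IntegrableOn (interSiteDiag L τ j V u γ) (cell (moireMatrix L)) ∧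
      Tendsto (interEnergyN L τ j V u γ) atTop (𝓝 (interEnergy L τ j V u γ)) := by
  have hP' := det_moireMatrix_ne_zero hP
  have hG : Integrable (torusSite L τ j V u) := (integrableOn_cell_prod_iff hP' (hL (1 - j)) _).1 hint
  have hK := (measurePreserving_torus_shear (disregistrySign j)).integrable_comp_of_integrable hG
  have hae := ae_integrable_and_tendsto_boxAverage
    (nonresonant_latticeHom_moireMatrix hL hP hinc j) hK
  filter_upwards [(quasiMeasurePreserving_shift_offset hL hP' j).ae hae] with γ hγ
  have hdiag : ∀ s, interSiteDiag L τ j V u γ (fromTorus (moireMatrix L) s) =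
      torusSite L τ j V u (s, disregistrySign j • s + toTorus (L (1 - j)) (diagOffset L j γ)) :=
    fun s => by rw [interSiteDiag_eq_torusSite hL hP hu hV, toTorus_fromTorus hP']
  refine ⟨?_, ?_⟩
  · rw [integrableOn_cell_iff hP']
    simp only [hdiag]
    exact hγ.1
  · rw [interEnergy_eq_setAverage hL hP hu hV, setAverage_cell hP',
      interEnergyN_eq_boxAverage hL hV]
    simp only [hdiag]
    -- Along the orbit only the first torus variable moves; the offset stays fixed.
    have hn : (fun n => interSiteDiag L τ j V u γ (latticePoint (L j) n + γ j)) = fun n =>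
        torusSite L τ j V u (toTorus (moireMatrix L) (γ j) + latticeHom (moireMatrix L) (L j) n,
          disregistrySign j •
            (toTorus (moireMatrix L) (γ j) + latticeHom (moireMatrix L) (L j) n) +
          toTorus (L (1 - j)) (diagOffset L j γ)) := funext fun n => by
      rw [interSiteDiag_eq_torusSite hL hP hu hV, map_add, latticeHom_apply,
        add_comm (toTorus _ (latticePoint _ _))]
    rw [hn]
    exact hγ.2

end Inter

/-! ### Pair potentials -/

lemma latticePoint_injective {M : Mat2} (hM : M.det ≠ 0) : Function.Injective (latticePoint M) := by
  intro m n h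
  have h1 := congrArg (act M⁻¹) h
  rw [latticePoint, latticePoint, act_inv_act hM, act_inv_act hM] at h1
  ext i
  have h2 := congrArg (fun x : E2 => x i) h1
  simpa using h2

/-- Integer coordinates on the lattice `M ℤ²`. -/
def latticeEquiv {M : Mat2} (hM : M.det ≠ 0) : (Fin 2 → ℤ) ≃ lattice M :=
  Equiv.ofInjective _ (latticePoint_injective hM)

lemma coe_latticeEquiv {M : Mat2} (hM : M.det ≠ 0) (n : Fin 2 → ℤ) :
    (latticeEquiv hM n : E2) = latticePoint M n := rfl

instance (M : Mat2) : Countable (lattice M) :=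
  (Set.countable_range (latticePoint M)).to_subtype

lemma norm_embed (x : E2) : ‖embed x‖ = ‖x‖ := by
  rw [EuclideanSpace.norm_eq, EuclideanSpace.norm_eq]
  congr 1
  rw [Fin.sum_univ_three, Fin.sum_univ_two]
  simp [embed]

lemma measurable_embed : Measurable embed := by
  have hc : Continuous embed := by
    refine (PiLp.continuous_toLp 2 _).comp (continuous_pi fun i => ?_)
    fin_cases i
    · exact (by fun_prop : Continuous fun x : E2 => x 0)
    · exact (by fun_prop : Continuous fun x : E2 => x 1)
    · exact continuous_const
  exact hc.measurable

lemma one_le_bracket (x : E3) : 1 ≤ bracket x :=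
  Real.one_le_sqrt.2 (by nlinarith [sq_nonneg ‖x‖])

lemma norm_le_bracket (x : E3) : ‖x‖ ≤ bracket x :=
  Real.le_sqrt_of_sq_le (by linarith)

/-- Integer coordinates are controlled by distances, uniformly in the base point. -/
lemma exists_norm_sub_le {M : Mat2} (hM : M.det ≠ 0) :
    ∃ K : ℝ, 0 ≤ K ∧ ∀ y : E2, ∃ m : Fin 2 → ℤ, ∀ n : Fin 2 → ℤ,
      ‖n - m‖ ≤ K * ‖y - latticePoint M n‖ + 1 := by
  obtain ⟨K, hK0, hK⟩ : ∃ K : ℝ, 0 < K ∧ ∀ x : E2, ‖act M⁻¹ x‖ ≤ K * ‖x‖ :=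
    (LinearMap.toContinuousLinearMap (Matrix.toEuclideanLin M⁻¹)).isBoundedLinearMap.bound
  -- `m` is the coordinatewise floor of `M⁻¹ y`; rounding accounts for the summand 1.
  refine ⟨K, hK0.le, fun y => ⟨fun i => ⌊act M⁻¹ y i⌋, fun n => ?_⟩⟩
  rw [pi_norm_le_iff_of_nonneg (by positivity)]
  intro i
  have h1 : |act M⁻¹ y i - n i| ≤ K * ‖y - latticePoint M n‖ := by
    have h2 : act M⁻¹ (y - latticePoint M n) i = act M⁻¹ y i - n i := by
      rw [act_sub, latticePoint, act_inv_act hM]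
      rfl
    rw [← h2, ← Real.norm_eq_abs]
    exact (PiLp.norm_apply_le _ i).trans (hK _)
  rw [Int.norm_eq_abs, Pi.sub_apply]
  push_cast
  have h3 := Int.floor_le (act M⁻¹ y i)
  have h4 := Int.lt_floor_add_one (act M⁻¹ y i)
  rw [abs_le] at h1 ⊢
  constructor <;> linarith

lemma le_rpow_neg_of_mul_le {a b C v s : ℝ} (hs : 0 ≤ s) (ha : 0 < a) (hab : a ≤ b)
    (hv : 0 ≤ v) (h : b ^ s * v ≤ C) : v ≤ C * a ^ (-s) := by
  have h1 : a ^ s ≤ b ^ s := Real.rpow_le_rpow ha.le hab hs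
  have h2 : 0 < a ^ s := Real.rpow_pos_of_pos ha s
  rw [Real.rpow_neg ha.le, ← div_eq_mul_inv, le_div_iff₀ h2]
  nlinarith

lemma measurableSet_slab (h : ℝ) : MeasurableSet (slab h) :=
  (by fun_prop : Measurable fun x : E3 => x 2) measurableSet_Icc

/-- Extension by zero off the slab gives a global Borel function that can be composed with positions
known to lie in the slab only almost everywhere. -/
lemma WeightedBounded.exists_measurable {s h : ℝ} {f : E3 → ℝ} (hf : WeightedBounded s (slab h) f) :
    ∃ g : E3 → ℝ, Measurable g ∧ ∀ x ∈ slab h, f x = g x := by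
  have he := MeasurableEmbedding.subtype_coe (measurableSet_slab h)
  refine ⟨Function.extend Subtype.val (fun x : slab h => f x) 0,
    he.measurable_extend hf.1 measurable_const, fun x hx => ?_⟩
  exact (Subtype.val_injective.extend_apply (fun x : slab h => f x) 0 ⟨x, hx⟩).symm

section Pair

variable {𝒜 : Fin 2 → Type*} [∀ k, Fintype (𝒜 k)]
  {L : Fin 2 → Mat2} {τ : ∀ k, 𝒜 k → E2} {j : Fin 2}
  {u : ∀ k, 𝒜 k → E2 → E3} {v : 𝒜 0 × 𝒜 1 → E3 → ℝ}

/-- Reindexing a `tsum` by a bijection needs no convergence, so invariance also holds where the sum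
takes its default value. -/
lemma pairPotential_translationInvariant {𝒜 : Fin 2 → Type*} (L : Fin 2 → Mat2)
    (v : 𝒜 0 × 𝒜 1 → E3 → ℝ) (j : Fin 2) (α : 𝒜 j) :
    TranslationInvariant (pairPotential L v j α) := by
  intro a R
  rw [pairPotential, pairPotential]
  congr 1
  exact ((Equiv.addRight R).prodCongr (Equiv.refl (𝒜 (1 - j)))).tsum_eq
    fun p : lattice (L (1 - j)) × 𝒜 (1 - j) => v (orderedPair j α p.2) (a p)

lemma ae_abs_vertical_le (hu : ∀ k α, MemLp (u k α) ⊤ volume) (k : Fin 2) (α : 𝒜 k) :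
    ∀ᵐ x, |u k α x 2| ≤ verticalNorm u k := by
  have hm : MemLp (fun x => u k α x 2) ⊤ volume := by
    refine (hu k α).of_le ?_ (.of_forall fun x => PiLp.norm_apply_le _ 2)
    exact (by fun_prop : Continuous fun y : E3 => y 2).comp_aestronglyMeasurable (hu k α).1
  have hle : (eLpNorm (fun x => u k α x 2) ⊤ volume).toReal ≤ verticalNorm u k :=
    le_ciSup (f := fun α => (eLpNorm (fun x => u k α x 2) ⊤ volume).toReal)
      (Set.finite_range _).bddAbove α
  have hae := ae_le_eLpNormEssSup (f := fun x => u k α x 2) (μ := (volume : Measure E2))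
  filter_upwards [hae] with x hx
  refine le_trans ?_ hle
  rw [← eLpNorm_exponent_top] at hx
  have := ENNReal.toReal_mono hm.2.ne hx
  simpa using this

lemma exists_ae_norm_le (hu : ∀ k α, MemLp (u k α) ⊤ volume) :
    ∃ C : ℝ, ∀ k α, ∀ᵐ x, ‖u k α x‖ ≤ C := by
  have h : ∀ k α, ∃ C : ℝ, ∀ᵐ x, ‖u k α x‖ ≤ C := fun k α => by
    refine ⟨(eLpNorm (u k α) ⊤ volume).toReal, ?_⟩
    filter_upwards [ae_le_eLpNormEssSup (f := u k α) (μ := (volume : Measure E2))] with x hx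
    rw [← eLpNorm_exponent_top] at hx
    have := ENNReal.toReal_mono (hu k α).2.ne hx
    simpa using this
  choose C hC using h
  refine ⟨∑ k, ∑ α, |C k α|, fun k α => ?_⟩
  filter_upwards [hC k α] with x hx
  calc ‖u k α x‖ ≤ |C k α| := hx.trans (le_abs_self _)
    _ ≤ ∑ α, |C k α| :=
      Finset.single_le_sum (f := fun α => |C k α|) (fun _ _ => abs_nonneg _) (Finset.mem_univ α)
    _ ≤ ∑ k, ∑ α, |C k α| := Finset.single_le_sum (f := fun k => ∑ α, |C k α|)
        (fun _ _ => by positivity) (Finset.mem_univ k)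

/-- The points at which the displacements obey the bound `C` and their vertical components the
essential bounds. -/
def regularPoints {𝒜 : Fin 2 → Type*} (u : ∀ k, 𝒜 k → E2 → E3) (C : ℝ) : Set E2 :=
  {x | ∀ k α, ‖u k α x‖ ≤ C ∧ |u k α x 2| ≤ verticalNorm u k}

lemma ae_mem_regularPoints (hu : ∀ k α, MemLp (u k α) ⊤ volume) {C : ℝ}
    (hC : ∀ k α, ∀ᵐ x, ‖u k α x‖ ≤ C) : ∀ᵐ x, x ∈ regularPoints u C :=
  ae_all_iff.2 fun k => ae_all_iff.2 fun α => (hC k α).and (ae_abs_vertical_le hu k α)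

lemma ae_forall_add_mem_regularPoints (hu : ∀ k α, MemLp (u k α) ⊤ volume) {C : ℝ}
    (hC : ∀ k α, ∀ᵐ x, ‖u k α x‖ ≤ C) (M : Mat2) :
    ∀ᵐ z : E2, ∀ R : lattice M, z + R ∈ regularPoints u C :=
  ae_all_iff.2 fun R => (measurePreserving_add_right volume (R : E2)).quasiMeasurePreserving.ae
    (ae_mem_regularPoints hu hC)

lemma verticalNorm_add_le_slabHeight {𝒜 : Fin 2 → Type*} {τ : ∀ k, 𝒜 k → E2}
    {u : ∀ k, 𝒜 k → E2 → E3} (j : Fin 2) :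
    verticalNorm u j + verticalNorm u (1 - j) ≤ slabHeight τ u := by
  have h : 0 ≤ sublatticeDist τ := Real.iSup_nonneg fun _ => norm_nonneg _
  rw [slabHeight]
  fin_cases j
  · change verticalNorm u 0 + verticalNorm u 1 ≤ _
    linarith
  · change verticalNorm u 1 + verticalNorm u 0 ≤ _
    linarith

lemma interStencil_mem_slab {𝒜 : Fin 2 → Type*} {L : Fin 2 → Mat2} {τ : ∀ k, 𝒜 k → E2}
    {j : Fin 2} {u : ∀ k, 𝒜 k → E2 → E3} {C : ℝ} {x z : E2} (hx : x ∈ regularPoints u C)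
    (hz : ∀ R : lattice (L (1 - j)), z + R ∈ regularPoints u C) (α : 𝒜 j)
    (s : lattice (L (1 - j)) × 𝒜 (1 - j)) :
    interStencil L τ u j α x z s ∈ slab (slabHeight τ u) := by
  have h0 : interStencil L τ u j α x z s 2 = u j α x 2 - u (1 - j) s.2 (z + s.1) 2 := by
    simp [interStencil, position, embed]
  have h1 := abs_le.1 (hx j α).2
  have h2 := abs_le.1 (hz s.1 (1 - j) s.2).2
  have h3 := verticalNorm_add_le_slabHeight (τ := τ) (u := u) j
  rw [slab, Set.mem_ofPred_eq, h0]
  constructor <;> linarith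

/-- The summands of a pair potential are dominated by a summable family of the integer
coordinates. -/
lemma exists_summable_bound (hL : ∀ j, (L j).det ≠ 0) {r : ℝ} (hr : 1 < r) {C : ℝ}
    (hv : ∀ p, WeightedBounded (2 * r) (slab (slabHeight τ u)) (v p)) :
    ∃ b : (Fin 2 → ℤ) → ℝ, Summable b ∧ ∀ x ∈ regularPoints u C, ∀ z : E2,
      (∀ R : lattice (L (1 - j)), z + R ∈ regularPoints u C) →
      ∃ m : Fin 2 → ℤ, ∀ (n : Fin 2 → ℤ) (α : 𝒜 j) (β : 𝒜 (1 - j)),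
        |v (orderedPair j α β)
          (interStencil L τ u j α x z (latticeEquiv (hL (1 - j)) n, β))| ≤ b (n - m) := by
  obtain ⟨K, hK0, hK⟩ := exists_norm_sub_le (hL (1 - j))
  choose Cv hCv using fun p => (hv p).2
  set B : ℝ := ∑ p, |Cv p| with hB
  have hB0 : 0 ≤ B := by positivity
  set T : ℝ := ∑ α : 𝒜 j, ∑ β : 𝒜 (1 - j), ‖τ j α - τ (1 - j) β‖ with hT
  have hT0 : 0 ≤ T := by positivity
  -- Since `bracket X ≥ 1`, each constant error may be multiplied by it, which gives `‖n - m‖ ≤ Q *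
  -- bracket X`.
  set Q : ℝ := K * (1 + T + 2 * |C|) + 1 with hQ
  have hQ0 : 0 < Q := by positivity
  have hsum1 : Summable fun k : Fin 2 → ℤ => ‖k‖ ^ (-(2 * r)) :=
    EisensteinSeries.summable_one_div_norm_rpow (by linarith)
  -- The real power `0 ^ (-(2 * r))` is `0`, so the term `k = 0` needs a separate bound.
  have hsum2 : Summable fun k : Fin 2 → ℤ => if k = 0 then (1 : ℝ) else 0 :=
    (hasSum_ite_eq 0 1).summable
  refine ⟨fun k => B * (Q⁻¹ ^ (-(2 * r)) * ‖k‖ ^ (-(2 * r)) + if k = 0 then 1 else 0),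
    ((hsum1.mul_left _).add hsum2).mul_left _, fun x hx z hz => ?_⟩
  obtain ⟨m, hm⟩ := hK (x - z)
  refine ⟨m, fun n α β => ?_⟩
  set X := interStencil L τ u j α x z (latticeEquiv (hL (1 - j)) n, β) with hX
  set p := orderedPair j α β
  have hCB : Cv p ≤ B := (le_abs_self _).trans
    (Finset.single_le_sum (f := fun p => |Cv p|) (fun _ _ => abs_nonneg _) (Finset.mem_univ p))
  have hvX : bracket X ^ (2 * r) * |v p X| ≤ B :=
    (hCv p X (interStencil_mem_slab hx hz α _)).trans hCB
  have hbr := one_le_bracket X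
  have hbr0 : 0 < bracket X := by linarith
  have hpow : 0 ≤ Q⁻¹ ^ (-(2 * r)) * ‖n - m‖ ^ (-(2 * r)) := by positivity
  change |v p X| ≤ B * (Q⁻¹ ^ (-(2 * r)) * ‖n - m‖ ^ (-(2 * r)) + if n - m = 0 then 1 else 0)
  by_cases hnm : n - m = 0
  · have h1 := le_rpow_neg_of_mul_le (by linarith) one_pos hbr (abs_nonneg _) hvX
    rw [Real.one_rpow, mul_one] at h1
    rw [if_pos hnm]
    nlinarith
  · rw [if_neg hnm, add_zero, ← Real.mul_rpow (by positivity) (norm_nonneg _)]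
    have hpos : 0 < ‖n - m‖ := norm_pos_iff.2 hnm
    refine le_rpow_neg_of_mul_le (by linarith) (by positivity) ?_ (abs_nonneg _) hvX
    rw [inv_mul_le_iff₀ hQ0]
    have hdiff : embed (x - z - latticePoint (L (1 - j)) n) =
        X - embed (τ j α - τ (1 - j) β) - u j α x +
          u (1 - j) β (z + latticePoint (L (1 - j)) n) := by
      have h : x - z - latticePoint (L (1 - j)) n =
          (x + τ j α) - (z + latticePoint (L (1 - j)) n + τ (1 - j) β) -
            (τ j α - τ (1 - j) β) := by abel
      rw [h, embed_sub, embed_sub]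
      simp only [hX, interStencil, position, coe_latticeEquiv]
      abel
    have hτ : ‖τ j α - τ (1 - j) β‖ ≤ T :=
      (Finset.single_le_sum (f := fun β => ‖τ j α - τ (1 - j) β‖)
        (fun _ _ => norm_nonneg _) (Finset.mem_univ β)).trans
        (Finset.single_le_sum (f := fun α => ∑ β : 𝒜 (1 - j), ‖τ j α - τ (1 - j) β‖)
          (fun _ _ => by positivity) (Finset.mem_univ α))
    have hu1 : ‖u j α x‖ ≤ |C| := (hx j α).1.trans (le_abs_self C)
    have hu2 : ‖u (1 - j) β (z + latticePoint (L (1 - j)) n)‖ ≤ |C| :=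
      (hz ⟨_, latticePoint_mem _ n⟩ (1 - j) β).1.trans (le_abs_self C)
    have hnorm : ‖x - z - latticePoint (L (1 - j)) n‖ ≤ ‖X‖ + T + 2 * |C| := by
      rw [← norm_embed, hdiff]
      refine (norm_add_le _ _).trans ?_
      have h1 := norm_sub_le (X - embed (τ j α - τ (1 - j) β)) (u j α x)
      have h2 := norm_sub_le X (embed (τ j α - τ (1 - j) β))
      rw [norm_embed] at h2
      linarith
    have hXb := norm_le_bracket X
    calc ‖n - m‖ ≤ K * ‖x - z - latticePoint (L (1 - j)) n‖ + 1 := hm n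
      _ ≤ K * (bracket X + T * bracket X + 2 * |C| * bracket X) + bracket X := by
        gcongr
        have h1 : T ≤ T * bracket X := le_mul_of_one_le_right hT0 hbr
        have h2 : 2 * |C| ≤ 2 * |C| * bracket X := le_mul_of_one_le_right (by positivity) hbr
        linarith
      _ = Q * bracket X := by rw [hQ]; ring

/-- Absolute convergence and a uniform bound for the sums over pairs. -/
lemma exists_bound_pairSum (hL : ∀ j, (L j).det ≠ 0) {r : ℝ} (hr : 1 < r) {C : ℝ}
    (hv : ∀ p, WeightedBounded (2 * r) (slab (slabHeight τ u)) (v p)) :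
    ∃ D : ℝ, ∀ x ∈ regularPoints u C, ∀ z : E2,
      (∀ R : lattice (L (1 - j)), z + R ∈ regularPoints u C) → ∀ α : 𝒜 j,
      (Summable fun s : lattice (L (1 - j)) × 𝒜 (1 - j) =>
        v (orderedPair j α s.2) (interStencil L τ u j α x z s)) ∧
      |pairPotential L v j α (interStencil L τ u j α x z)| ≤ D := by
  obtain ⟨b, hb, hbound⟩ := exists_summable_bound (C := C) (j := j) hL hr hv
  have hprod : Summable fun t : (Fin 2 → ℤ) × 𝒜 (1 - j) => b t.1 := by
    have h := Summable.mul_of_nonneg (f := fun n => |b n|) (g := fun _ : 𝒜 (1 - j) => (1 : ℝ))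
      hb.abs (Summable.of_finite) (fun _ => abs_nonneg _) (fun _ => zero_le_one)
    refine Summable.of_abs ?_
    simpa using h
  refine ⟨1 / 2 * ∑' t : (Fin 2 → ℤ) × 𝒜 (1 - j), b t.1, fun x hx z hz α => ?_⟩
  obtain ⟨m, hm⟩ := hbound x hx z hz
  let e : (Fin 2 → ℤ) × 𝒜 (1 - j) ≃ lattice (L (1 - j)) × 𝒜 (1 - j) :=
    (latticeEquiv (hL (1 - j))).prodCongr (Equiv.refl _)
  let e' : (Fin 2 → ℤ) × 𝒜 (1 - j) ≃ (Fin 2 → ℤ) × 𝒜 (1 - j) :=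
    (Equiv.subRight m).prodCongr (Equiv.refl _)
  have hb' : Summable fun t : (Fin 2 → ℤ) × 𝒜 (1 - j) => b (t.1 - m) :=
    (e'.summable_iff (f := fun t : (Fin 2 → ℤ) × 𝒜 (1 - j) => b t.1)).2 hprod
  -- The centre `m` depends on the positions, but translating by it leaves the total unchanged;
  -- hence one bound for all positions.
  have htsum : ∑' t : (Fin 2 → ℤ) × 𝒜 (1 - j), b (t.1 - m) =
      ∑' t : (Fin 2 → ℤ) × 𝒜 (1 - j), b t.1 :=
    e'.tsum_eq fun t : (Fin 2 → ℤ) × 𝒜 (1 - j) => b t.1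
  set F : lattice (L (1 - j)) × 𝒜 (1 - j) → ℝ := fun s =>
    v (orderedPair j α s.2) (interStencil L τ u j α x z s) with hF
  have hle : ∀ t, ‖F (e t)‖ ≤ b (t.1 - m) := fun t => hm t.1 α t.2
  have hsum : Summable fun t => F (e t) := Summable.of_norm_bounded hb' hle
  refine ⟨(e.summable_iff (f := F)).1 hsum, ?_⟩
  have h1 : pairPotential L v j α (interStencil L τ u j α x z) = 1 / 2 * ∑' t, F (e t) := by
    rw [e.tsum_eq F]
    rfl
  rw [h1, abs_mul, abs_of_pos (by norm_num : (0 : ℝ) < 1 / 2), ← htsum]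
  gcongr
  exact tsum_of_norm_bounded hb'.hasSum hle

/-! ### Measurability and boundedness along families of positions. -/

section Measurability

variable {Ω : Type*} [MeasurableSpace Ω] {μ : Measure Ω} {X Z : Ω → E2}

lemma aemeasurable_interStencil {𝒜 : Fin 2 → Type*} {L : Fin 2 → Mat2} {τ : ∀ k, 𝒜 k → E2}
    {j : Fin 2} {u : ∀ k, 𝒜 k → E2 → E3} (hu : ∀ k α, MemLp (u k α) ⊤ volume)
    (hX : Measure.QuasiMeasurePreserving X μ volume)
    (hZ : Measure.QuasiMeasurePreserving Z μ volume) (α : 𝒜 j)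
    (s : lattice (L (1 - j)) × 𝒜 (1 - j)) :
    AEMeasurable (fun ω => interStencil L τ u j α (X ω) (Z ω) s) μ := by
  have hZs : Measure.QuasiMeasurePreserving (fun ω => Z ω + s.1) μ volume :=
    (measurePreserving_add_right volume (s.1 : E2)).quasiMeasurePreserving.comp hZ
  have h1 : AEMeasurable (fun ω => u j α (X ω)) μ :=
    ((hu j α).1.comp_quasiMeasurePreserving hX).aemeasurable
  have h2 : AEMeasurable (fun ω => u (1 - j) s.2 (Z ω + s.1)) μ :=
    ((hu (1 - j) s.2).1.comp_quasiMeasurePreserving hZs).aemeasurable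
  have h3 : Measurable fun ω => embed (X ω + τ j α) :=
    measurable_embed.comp (hX.measurable.add_const _)
  have h4 : Measurable fun ω => embed (Z ω + s.1 + τ (1 - j) s.2) :=
    measurable_embed.comp (hZs.measurable.add_const _)
  exact (h3.aemeasurable.add h1).sub (h4.aemeasurable.add h2)

/-- Pair potentials along measurable families of positions. -/
theorem pairPotential_along (hL : ∀ j, (L j).det ≠ 0) {r : ℝ} (hr : 1 < r)
    (hu : ∀ k α, MemLp (u k α) ⊤ volume)
    (hv : ∀ p, WeightedBounded (2 * r) (slab (slabHeight τ u)) (v p))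
    (hX : Measure.QuasiMeasurePreserving X μ volume)
    (hZ : Measure.QuasiMeasurePreserving Z μ volume) (α : 𝒜 j) :
    (∀ᵐ ω ∂μ, Summable fun s : lattice (L (1 - j)) × 𝒜 (1 - j) =>
      v (orderedPair j α s.2) (interStencil L τ u j α (X ω) (Z ω) s)) ∧
    AEStronglyMeasurable (fun ω =>
      pairPotential L v j α (interStencil L τ u j α (X ω) (Z ω))) μ ∧
    ∃ D : ℝ, ∀ᵐ ω ∂μ, ‖pairPotential L v j α (interStencil L τ u j α (X ω) (Z ω))‖ ≤ D := by
  obtain ⟨C, hC⟩ := exists_ae_norm_le hu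
  obtain ⟨D, hD⟩ := exists_bound_pairSum (C := C) (j := j) hL hr hv
  have hreg : ∀ᵐ ω ∂μ, X ω ∈ regularPoints u C ∧
      ∀ R : lattice (L (1 - j)), Z ω + R ∈ regularPoints u C :=
    (hX.ae (ae_mem_regularPoints hu hC)).and
      (hZ.ae (ae_forall_add_mem_regularPoints hu hC (L (1 - j))))
  have hsum : ∀ᵐ ω ∂μ, Summable fun s : lattice (L (1 - j)) × 𝒜 (1 - j) =>
      v (orderedPair j α s.2) (interStencil L τ u j α (X ω) (Z ω) s) := by
    filter_upwards [hreg] with ω hω using (hD _ hω.1 _ hω.2 α).1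
  refine ⟨hsum, ?_, D, ?_⟩
  · have hterm : ∀ s : lattice (L (1 - j)) × 𝒜 (1 - j), AEStronglyMeasurable (fun ω =>
        v (orderedPair j α s.2) (interStencil L τ u j α (X ω) (Z ω) s)) μ := fun s => by
      obtain ⟨g, hg, hvg⟩ := (hv (orderedPair j α s.2)).exists_measurable
      refine (hg.comp_aemeasurable
        (aemeasurable_interStencil (τ := τ) hu hX hZ α s)).aestronglyMeasurable.congr ?_
      filter_upwards [hreg] with ω hω
      exact (hvg _ (interStencil_mem_slab hω.1 hω.2 α s)).symm
    have htsum : AEStronglyMeasurable (fun ω =>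
        ∑' s : lattice (L (1 - j)) × 𝒜 (1 - j),
          v (orderedPair j α s.2) (interStencil L τ u j α (X ω) (Z ω) s)) μ := by
      -- The index set is countable, so finite partial sums converge along a countably generated
      -- filter and measurability passes to the limit.
      refine aestronglyMeasurable_of_tendsto_ae atTop
        (f := fun (F : Finset (lattice (L (1 - j)) × 𝒜 (1 - j))) ω =>
          ∑ s ∈ F, v (orderedPair j α s.2) (interStencil L τ u j α (X ω) (Z ω) s)) (fun F => ?_) ?_
      · exact F.aestronglyMeasurable_fun_sum fun s _ => hterm s
      · filter_upwards [hsum] with ω hω using hω.hasSum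
    exact htsum.const_mul _
  · filter_upwards [hreg] with ω hω using (hD _ hω.1 _ hω.2 α).2

/-- The generalized site potential of pair potentials along measurable families of positions. -/
theorem interSite_pairPotential_along (hL : ∀ j, (L j).det ≠ 0) {r : ℝ} (hr : 1 < r)
    (hu : ∀ k α, MemLp (u k α) ⊤ volume)
    (hv : ∀ p, WeightedBounded (2 * r) (slab (slabHeight τ u)) (v p))
    (hX : Measure.QuasiMeasurePreserving X μ volume)
    (hZ : Measure.QuasiMeasurePreserving Z μ volume) :
    AEStronglyMeasurable (fun ω =>
      interSite L τ j (pairPotential L v j) u (X ω) (X ω - Z ω)) μ ∧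
    ∃ D : ℝ, ∀ᵐ ω ∂μ, ‖interSite L τ j (pairPotential L v j) u (X ω) (X ω - Z ω)‖ ≤ D := by
  have h := fun α : 𝒜 j => pairPotential_along (τ := τ) hL hr hu hv hX hZ α
  simp only [interSite_sub]
  choose D hD using fun α => (h α).2.2
  refine ⟨(Finset.univ.aestronglyMeasurable_fun_sum fun α _ => (h α).2.1).const_mul _,
    |(cellArea (L j))⁻¹| * ∑ α, D α, ?_⟩
  filter_upwards [ae_all_iff.2 hD] with ω hω
  rw [norm_mul, Real.norm_eq_abs]
  gcongr
  exact (norm_sum_le _ _).trans (Finset.sum_le_sum fun α _ => hω α)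

end Measurability

lemma integrableOn_interSite_pairPotential (hL : ∀ j, (L j).det ≠ 0)
    (hP : (moireMatrix L).det ≠ 0) {r : ℝ} (hr : 1 < r) (hu : ∀ k α, MemLp (u k α) ⊤ volume)
    (hv : ∀ p, WeightedBounded (2 * r) (slab (slabHeight τ u)) (v p)) :
    IntegrableOn (fun p : E2 × E2 => interSite L τ j (pairPotential L v j) u p.1 p.2)
      (cell (moireMatrix L) ×ˢ cell (L (1 - j))) := by
  have hm : Measurable fun p : E2 × E2 => p.1 - p.2 := measurable_fst.sub measurable_snd
  have hshear : MeasurePreserving (fun p : E2 × E2 => (p.1, p.1 - p.2)) volume volume :=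
    (MeasurePreserving.id (volume : Measure E2)).skew_product (g := fun a b => a - b) hm
      (.of_forall fun a => (Measure.measurePreserving_sub_left volume a).map_eq)
  have hZ : Measure.QuasiMeasurePreserving (fun p : E2 × E2 => p.1 - p.2) volume volume :=
    Measure.quasiMeasurePreserving_snd.comp hshear.quasiMeasurePreserving
  obtain ⟨h1, D, h2⟩ := interSite_pairPotential_along (j := j) (τ := τ) (μ := volume)
    (X := fun p : E2 × E2 => p.1) hL hr hu hv Measure.quasiMeasurePreserving_fst hZ
  simp only [sub_sub_cancel] at h1 h2
  refine Measure.integrableOn_of_bounded ?_ h1 (M := D) (ae_restrict_of_ae h2)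
  rw [Measure.volume_eq_prod, Measure.prod_prod]
  exact ENNReal.mul_ne_top (volume_cell_ne_zero_ne_top hP).2 (volume_cell_ne_zero_ne_top (hL _)).2

/-- On the diagonal the base point of the opposite layer is an invertible affine function of `x`,
which preserves null sets for each fixed `γ`; no shift is exceptional. -/
lemma integrableOn_interSiteDiag_pairPotential (hL : ∀ j, (L j).det ≠ 0)
    (hP : (moireMatrix L).det ≠ 0) {r : ℝ} (hr : 1 < r) (hu : ∀ k α, MemLp (u k α) ⊤ volume)
    (hv : ∀ p, WeightedBounded (2 * r) (slab (slabHeight τ u)) (v p)) (γ : Fin 2 → E2) :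
    IntegrableOn (interSiteDiag L τ j (pairPotential L v j) u γ) (cell (moireMatrix L)) := by
  have hB : (L (1 - j) * (L j)⁻¹).det ≠ 0 := by
    rw [Matrix.det_mul]
    exact mul_ne_zero (hL _) (det_inv_ne_zero (hL j))
  have hZ : Measure.QuasiMeasurePreserving
      (fun x : E2 => act (L (1 - j) * (L j)⁻¹) (x - γ j) + γ (1 - j)) volume volume :=
    (measurePreserving_add_right volume (γ (1 - j))).quasiMeasurePreserving.comp
      ((quasiMeasurePreserving_act hB).comp
        (measurePreserving_sub_right volume (γ j)).quasiMeasurePreserving)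
  obtain ⟨h1, D, h2⟩ := interSite_pairPotential_along (j := j) (τ := τ) (μ := volume)
    (X := fun x : E2 => x) hL hr hu hv (MeasurePreserving.id volume).quasiMeasurePreserving hZ
  simp only [← interSiteDiag_eq] at h1 h2
  exact Measure.integrableOn_of_bounded (volume_cell_ne_zero_ne_top hP).2 h1 (M := D)
    (ae_restrict_of_ae h2)

end Pair

end TwistedBilayer

end

/-! ### Assembly of the three statements. -/

open TwistedBilayer in
theorem theorem2p2
    (θ q : ℝ) (hq : 0 < q) (A : Mat2) (hA : A.det ≠ 0)
    (L : Fin 2 → Mat2) (hL : L = layerMatrix θ q A)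
    (hinc : Incommensurate (L 0) (L 1))
    (hinc_rec : Incommensurate (reciprocal (L 0)) (reciprocal (L 1)))
    {𝒜 : Fin 2 → Type*} [∀ k, Fintype (𝒜 k)]
    (τ : ∀ k, 𝒜 k → E2)
    (u : ∀ k, 𝒜 k → E2 → E3)
    (hu_per : ∀ k α, MoirePeriodic L (u k α))
    (hu_int : ∀ k α, IntegrableOn (u k α) (cell (moireMatrix L)))
    (j : Fin 2) :
    -- monolayer energies
    (∀ V : 𝒜 j → (lattice (L j) × 𝒜 j → E3) → ℝ,
      IntegrableOn (monoSite (L j) V (u j)) (cell (moireMatrix L)) →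
        monoEnergy (moireMatrix L) (L j) V (u j) =
            ⨍ x in cell (moireMatrix L), monoSite (L j) V (u j) x ∧
        ∀ᵐ γ : Fin 2 → E2, (∀ k, γ k ∈ cell (L k)) →
          Tendsto (monoEnergyN (L j) V (u j) (γ j)) atTop
            (𝓝 (monoEnergy (moireMatrix L) (L j) V (u j)))) ∧
    -- interlayer energies, many-body potentials
    (∀ V : 𝒜 j → InterConfig 𝒜 L j → ℝ,
      (∀ α, TranslationInvariant (V α)) →
      (∀ α, Function.Even (V α)) →
      IntegrableOn (fun p : E2 × E2 => interSite L τ j V u p.1 p.2)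
        (cell (moireMatrix L) ×ˢ cell (L (1 - j))) →
        ∀ᵐ γ : Fin 2 → E2, (∀ k, γ k ∈ cell (L k)) →
          IntegrableOn (interSiteDiag L τ j V u γ) (cell (moireMatrix L)) ∧
          interEnergy L τ j V u γ =
            ⨍ x in cell (moireMatrix L), interSiteDiag L τ j V u γ x ∧
          Tendsto (interEnergyN L τ j V u γ) atTop (𝓝 (interEnergy L τ j V u γ))) ∧
    -- interlayer energies, pair potentials
    (∀ (v : 𝒜 0 × 𝒜 1 → E3 → ℝ) (r : ℝ), 1 < r →
      (∀ p, Function.Even (v p)) →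
      (∀ k α, MemLp (u k α) ⊤ volume) →
      (∀ p, WeightedBounded (2 * r) (slab (slabHeight τ u)) (v p)) →
        (∀ α : 𝒜 j, ∀ᵐ p : E2 × E2,
          Summable fun s : lattice (L (1 - j)) × 𝒜 (1 - j) =>
            v (orderedPair j α s.2) (interStencil L τ u j α p.1 p.2 s)) ∧
        IntegrableOn (fun p : E2 × E2 => interSite L τ j (pairPotential L v j) u p.1 p.2)
          (cell (moireMatrix L) ×ˢ cell (L (1 - j))) ∧
        (∀ γ : Fin 2 → E2, (∀ k, γ k ∈ cell (L k)) →
          IntegrableOn (interSiteDiag L τ j (pairPotential L v j) u γ) (cell (moireMatrix L))) ∧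
        ∀ᵐ γ : Fin 2 → E2, (∀ k, γ k ∈ cell (L k)) →
          interEnergy L τ j (pairPotential L v j) u γ =
            ⨍ x in cell (moireMatrix L), interSiteDiag L τ j (pairPotential L v j) u γ x ∧
          Tendsto (interEnergyN L τ j (pairPotential L v j) u γ) atTop
            (𝓝 (interEnergy L τ j (pairPotential L v j) u γ))) := by
  subst hL
  set L := layerMatrix θ q A
  have hLdet : ∀ j, (L j).det ≠ 0 := det_layerMatrix_ne_zero hq hA
  have hP : ((L 0)⁻¹ - (L 1)⁻¹).det ≠ 0 := det_inv_sub_inv_ne_zero hq hA hinc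
  have hP' : (moireMatrix L).det ≠ 0 := det_moireMatrix_ne_zero hP
  refine ⟨fun V hV => ?_, fun V hV _ hint => ?_, fun v r hr _ hu hv => ?_⟩
  · have hen := monoEnergy_eq_setAverage (hLdet j) hP' V (u j)
    refine ⟨hen, ?_⟩
    have hae := ae_tendsto_boxAverage_latticePoint hP'
      (nonresonant_latticeHom_moireMatrix hLdet hP hinc j)
      (monoSite_add_latticePoint V (hu_per j)) hV
    have hproj : Measure.QuasiMeasurePreserving (fun γ : Fin 2 → E2 => γ j) volume volume :=
      Measure.quasiMeasurePreserving_eval _ j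
    filter_upwards [hproj.ae hae] with γ hγ _
    rw [hen, monoEnergyN_eq_boxAverage]
    exact hγ
  · filter_upwards [ae_integrableOn_and_tendsto_interEnergyN hLdet hP hinc hu_per hV hint]
      with γ hγ _
    exact ⟨hγ.1, interEnergy_eq_setAverage hLdet hP hu_per hV γ, hγ.2⟩
  · have hV := pairPotential_translationInvariant L v j
    have hint := integrableOn_interSite_pairPotential (j := j) hLdet hP' hr hu hv
    refine ⟨fun α => (pairPotential_along hLdet hr hu hv Measure.quasiMeasurePreserving_fst
      Measure.quasiMeasurePreserving_snd α).1, hint, fun γ _ =>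
        integrableOn_interSiteDiag_pairPotential hLdet hP' hr hu hv γ, ?_⟩
    filter_upwards [ae_integrableOn_and_tendsto_interEnergyN hLdet hP hinc hu_per hV hint]
      with γ hγ _
    exact ⟨interEnergy_eq_setAverage hLdet hP hu_per hV γ, hγ.2⟩
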